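/- Let $p_0=1$, $q_0=0$, and let $p_i,q_i>0$ with $p_i+q_i=1$ for $i\ge1$. Let $X$ be a continuous-time random walk on $\{0,1,2,\dots\}$ whose embedded Markov chain $(X_k)_{k\ge0}$ jumps from $i$ to $i+1$ with probability $p_i$ and from $i$ to $i-1$ with probability $q_i$, and whose right and left waiting times have the laws of positive random variables $\tau_i^+$, $\tau_i^-$: with $T_0=0$ and $T_{k+1}=T_k+\tau^k$, where $\tau^k=\tau^{+}_{i,k}$ if $X_k=i$, $X_{k+1}=i+1$ and $\tau^k=\tau^{-}_{i,k}$ if $X_k=i$, $X_{k+1}=i-1$, one puts $X(t)=X_k$ for $t\in[T_k,T_{k+1})$; here $\tau^{\pm}_{i,k}$ ($k\ge0$) are copies of $\tau_i^\pm$, and all these copies are mutually independent and independent of the chain. For $i,k\ge 0$ put $$\delta_k=\frac{q_1\cdots q_k}{p_1\cdots p_k},\qquad \nu_i=\bigl(1-p_i\,\mathsf E e^{-\tau_i^+}-q_i\,\mathsf E e^{-\tau_i^-}\bigr)\frac{p_1\cdots p_{i-1}}{q_1\cdots q_i},$$ where empty products are equal to $1$. Let $Y_0,Y_1,Y_2,\dots$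 be independent such walks (with the same parameters) with $Y_n(0)=n$, let $\theta_n=\inf\{t\ge0: Y_n(t)=n-1\}\in[0,\infty]$ for $n\ge1$, and say that the walk implodes from $\infty$ on the event $\{\sum_{k\ge1}\theta_k<\infty\}$. Then this event has probability $0$ or $1$ (it does not involve any initial distribution of $X$), and $$\mathsf P\{X\text{ implodes from }\infty\}=1\iff \sum_{k=0}^\infty\Bigl(\sum_{i=k+1}^\infty\nu_i\Bigr)\delta_k<\infty\ \text{ and }\ \sum_{k=0}^\infty\delta_k=\infty,$$ $$\mathsf P\{X\text{ implodes from }\infty\}=0\iff \sum_{k=0}^\infty\Bigl(\sum_{i=k+1}^\infty\nu_i\Bigr)\delta_k=\infty\ \text{ or }\ \sum_{k=0}^\infty\delta_k<\infty.$$ Moreover, implosion in the sense that $\lim_{C\to+\infty}\sup_{i\ge0}\mathsf P_i(\sigma_0>C)=0$, where $\sigma_0=\inf\{t\ge0: X(t)=0\}\in[0,\infty]$ and $\mathsf P_i$ is the law of the walk started at $i$, is also equivalent to $\sum_{k}(\sum_{i>k}\nu_i)\delta_k<\infty$ and $\sum_k\delta_k=\infty$. -/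

import Mathlib

open MeasureTheory ProbabilityTheory Filter
open scoped ENNReal NNReal Topology

noncomputable section

namespace CTRW

/-- The parameters of a birth-and-death continuous-time random walk on `{0, 1, 2, …}`:
the probabilities `p i`, `q i` of a jump `i → i + 1`, `i → i - 1`, and the laws
`wait true i`, `wait false i` of the right and left waiting times `τ⁺_i`, `τ⁻_i`,
which are positive random variables. -/
structure Params where
  p : ℕ → ℝ
  q : ℕ → ℝ
  p_zero : p 0 = 1
  q_zero : q 0 = 0
  p_pos : ∀ i, 1 ≤ i → 0 < p i
  q_pos : ∀ i, 1 ≤ i → 0 < q i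
  p_add_q : ∀ i, 1 ≤ i → p i + q i = 1
  wait : Bool → ℕ → Measure ℝ
  wait_prob : ∀ b i, IsProbabilityMeasure (wait b i)
  wait_pos : ∀ b i, ∀ᵐ x ∂(wait b i), 0 < x

namespace Params

variable (D : Params)

/-- Transition probabilities of the embedded Markov chain. -/
def trans (i j : ℕ) : ℝ :=
  if j = i + 1 then D.p i else if j + 1 = i then D.q i else 0

/-- The Laplace transform `E exp (-τ_i)` at `1` of the time spent in `i` before a jump. -/
def laplace (i : ℕ) : ℝ :=
  D.p i * (∫ x, Real.exp (-x) ∂(D.wait true i)) + D.q i * (∫ x, Real.exp (-x) ∂(D.wait false i))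

/-- The scale `δ_k = (q_1 ⋯ q_k) / (p_1 ⋯ p_k)`. -/
def scale (k : ℕ) : ℝ :=
  (∏ j ∈ Finset.Icc 1 k, D.q j) / (∏ j ∈ Finset.Icc 1 k, D.p j)

/-- The speed measure `ν_i = (1 - E exp (-τ_i)) (p_1 ⋯ p_{i-1}) / (q_1 ⋯ q_i)`. -/
def speed (i : ℕ) : ℝ :=
  (1 - D.laplace i) * ((∏ j ∈ Finset.Ico 1 i, D.p j) / (∏ j ∈ Finset.Icc 1 i, D.q j))

/-- The series `∑_{k ≥ 0} (∑_{i ≥ k + 1} ν_i) δ_k` of nonnegative terms, with values in `[0, ∞]`. -/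
def implosionSeries : ℝ≥0∞ :=
  ∑' k : ℕ, (∑' j : ℕ, ENNReal.ofReal (D.speed (k + 1 + j))) * ENNReal.ofReal (D.scale k)

/-- The series `∑_{k ≥ 0} δ_k` of positive terms, with values in `[0, ∞]`. -/
def scaleSeries : ℝ≥0∞ :=
  ∑' k : ℕ, ENNReal.ofReal (D.scale k)

end Params

/-- The data from which one trajectory is built: the path `X_0, X_1, …` of the embedded chain,
and the values of all waiting times: `w.2 true i k` is `τ⁺_{i,k}` and `w.2 false i k` is
`τ⁻_{i,k}`. -/
abbrev Outcome : Type := (ℕ → ℕ) × (Bool → ℕ → ℕ → ℝ)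

namespace Outcome

/-- The waiting time before the jump from `X_k` to `X_{k+1}`. -/
def holding (w : Outcome) (k : ℕ) : ℝ :=
  if w.1 (k + 1) = w.1 k + 1 then w.2 true (w.1 k) k else w.2 false (w.1 k) k

/-- The moments of jumps `T_0 = 0`, `T_{k+1} = T_k + τ^k`. -/
def jumpTime (w : Outcome) (k : ℕ) : ℝ :=
  ∑ j ∈ Finset.range k, holding w j

open Classical in
/-- The trajectory: `X(t) = X_k` for `t ∈ [T_k, T_{k+1})`. It is undefined (`none`) if there is
no such `k`, that is, from `lim T_k` on when this limit is finite. -/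
def state (w : Outcome) (t : ℝ≥0) : Option ℕ :=
  if h : ∃ k : ℕ, jumpTime w k ≤ (t : ℝ) ∧ (t : ℝ) < jumpTime w (k + 1) then
    some (w.1 (Nat.find h))
  else none

/-- The hitting time `σ_n = inf {t ≥ 0 | X(t) = n}`, which is `∞` if `n` is never hit. -/
def hittingTime (w : Outcome) (n : ℕ) : ℝ≥0∞ :=
  ⨅ (t : ℝ≥0) (_ : state w t = some n), (t : ℝ≥0∞)

end Outcome

/-- `W` is a realization, on the probability space `(Ω, P)`, of the continuous-time random walk
with parameters `D` and initial state `n`: the embedded chain is a Markov chain with transition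
probabilities `D.trans` started in `n`, the waiting times have the given laws and are mutually
independent, and they are independent of the chain. -/
structure IsWalkFrom {Ω : Type*} [MeasurableSpace Ω] (D : Params) (P : Measure Ω)
    (W : Ω → Outcome) (n : ℕ) : Prop where
  measurable : Measurable W
  initial : ∀ᵐ ω ∂P, (W ω).1 0 = n
  markov : ∀ (k : ℕ) (x : ℕ → ℕ),
    P {ω | ∀ j ≤ k + 1, (W ω).1 j = x j}
      = P {ω | ∀ j ≤ k, (W ω).1 j = x j} * ENNReal.ofReal (D.trans (x k) (x (k + 1)))
  law : ∀ (b : Bool) (i k : ℕ), P.map (fun ω => (W ω).2 b i k) = D.wait b i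
  indep_wait : iIndepFun (fun (a : Bool × ℕ × ℕ) (ω : Ω) => (W ω).2 a.1 a.2.1 a.2.2) P
  indep_chain : IndepFun (fun ω => (W ω).1) (fun ω => (W ω).2) P

section Implosion

variable {Ω : Type*}

/-- For walks `Y n` started in `n`, the passage time of `Y n` from `n` to `n - 1`
is `passageTime Y n` (`n ≥ 1`). -/
def passageTime (Y : ℕ → Ω → Outcome) (n : ℕ) (ω : Ω) : ℝ≥0∞ :=
  Outcome.hittingTime (Y n ω) (n - 1)

/-- The event `{ρ_∞ < ∞}` of implosion, where `ρ_∞ = θ_1 + θ_2 + ⋯`. -/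
def implosionEvent (Y : ℕ → Ω → Outcome) : Set Ω :=
  {ω | ∑' k : ℕ, passageTime Y (k + 1) ω < ∞}

/-- Implosion in terms of laws: `sup_i P_i (σ_0 > C) → 0` as `C → ∞`, where the law of the walk
under `P_i` is that of `Y i` under `P`. -/
def ImplodesInLaw [MeasurableSpace Ω] (P : Measure Ω) (Y : ℕ → Ω → Outcome) : Prop :=
  Tendsto (fun C : ℝ => ⨆ i : ℕ, P {ω | ENNReal.ofReal C < Outcome.hittingTime (Y i ω) 0})
    atTop (𝓝 0)

end Implosion

end CTRW

end

/-!
For `l ≥ 0` let `v i = E_i exp (-l σ_0)` (`Params.toZero`), with `exp (-l ∞) = 0` even for `l = 0`,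
so that `l = 0` gives the hitting probability. Given the path of the chain, the waiting times are
independent, so `v` is the sum over all paths from `i` to `0`, stopped at their first visit to `0`,
of products of the kernel `P (i → y) E exp (-l τ)` (`IsWalkFrom.lintegral_expNeg`). Consequently `v`
satisfies the first-step equation and is its smallest nonnegative solution with `v 0 = 1`
(`hitTotal_mul_le`). Minimality replaces the strong Markov property: it yields
`v N = ∏_{n ≤ N} E exp (-l θ_n)` (`Params.prod_hitLaplace`), and it bounds the hitting probability
of `0` from `i` by `∑_{k ≥ i} δ_k / ∑_k δ_k` in the transient case.

All the conditions of the theorem turn out to be equivalent to `inf v > 0` for `l = 1`.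

* The series (`Params.exists_le_toZero_iff`). Put `g k = (v k - v (k + 1)) / δ_k`. The first-step
  equation says that `g` is nonincreasing, with `ν_i v (i + 1) ≤ g (i - 1) - g i ≤ ν_i v (i - 1)`.
  If `inf v = c > 0`, then `c ∑_{i > k} ν_i ≤ g k`, and summing `δ_k g k` shows that the double
  series is at most `1 / c`. Conversely, if `∑ δ_k = ∞`, then `g → 0` because `v` is bounded, so
  `v k - v (k + 1) ≤ v k δ_k ∑_{i > k} ν_i`, which keeps `v` away from zero when the double
  series converges. With `l = 0` the same argument shows that the walk is recurrent.
* Implosion. If `inf v = 0`, then `E exp (-ρ_∞) ≤ v N` for all `N`, so `ρ_∞ = ∞` almost surely. If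
  `inf v > 0`, then the `θ_n` are finite by recurrence and `∑ E (1 - exp (-θ_n)) < ∞`, so `ρ_∞ < ∞`
  almost surely (`ae_tsum_descent_lt_top`).
* Implosion in law. It bounds `v` below by `exp (-C) / 2` for some `C`. In the other direction,
  `E_i exp (-σ_0 / C) ≥ E exp (-ρ_∞ / C) → 1` uniformly in `i`.
-/

open MeasureTheory ProbabilityTheory Filter
open scoped ENNReal NNReal Topology

noncomputable section

namespace CTRW

/-! ### First-passage weights of a nonnegative kernel -/

/-- The total `A`-weight of the paths of length `k` which start in `i` and
reach `m` at their last step for the first time. -/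
def hitWeight (A : ℕ → ℕ → ℝ≥0∞) (m : ℕ) : ℕ → ℕ → ℝ≥0∞
  | 0, i => if i = m then 1 else 0
  | k + 1, i => if i = m then 0 else ∑' y, A i y * hitWeight A m k y

/-- The total `A`-weight of all paths from `i` to `m` stopped at their first visit to `m`. -/
def hitTotal (A : ℕ → ℕ → ℝ≥0∞) (m i : ℕ) : ℝ≥0∞ := ∑' k, hitWeight A m k i

lemma hitTotal_self (A : ℕ → ℕ → ℝ≥0∞) (m : ℕ) : hitTotal A m m = 1 := by
  rw [hitTotal, tsum_eq_single 0]
  · simp [hitWeight]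
  · intro k hk
    obtain ⟨k, rfl⟩ := Nat.exists_eq_succ_of_ne_zero hk
    simp [hitWeight]

/-- First-step equation. -/
lemma hitTotal_of_ne (A : ℕ → ℕ → ℝ≥0∞) {m i : ℕ} (h : i ≠ m) :
    hitTotal A m i = ∑' y, A i y * hitTotal A m y := by
  have h1 : hitTotal A m i = hitWeight A m 0 i + ∑' k, hitWeight A m (k + 1) i :=
    tsum_eq_zero_add' ENNReal.summable
  rw [h1]
  simp only [hitWeight, h, if_false, zero_add, hitTotal]
  rw [ENNReal.tsum_comm]
  exact tsum_congr fun y => ENNReal.tsum_mul_left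

/-- Minimality: on a set `s` which the kernel can leave only through `m`, the first-passage weight
is dominated by every supersolution of the first-step equation. -/
lemma hitTotal_mul_le (A : ℕ → ℕ → ℝ≥0∞) {m : ℕ} (s : Set ℕ)
    (hs : ∀ i ∈ s, i ≠ m → ∀ y, y ∉ s → A i y = 0) (c : ℝ≥0∞) (f : ℕ → ℝ≥0∞) (hm : c ≤ f m)
    (hf : ∀ i ∈ s, i ≠ m → ∑' y, A i y * f y ≤ f i) {i : ℕ} (hi : i ∈ s) :
    hitTotal A m i * c ≤ f i := by
  have key : ∀ K : ℕ, ∀ i ∈ s, (∑ k ∈ Finset.range K, hitWeight A m k i) * c ≤ f i := by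
    intro K
    induction K with
    | zero => simp
    | succ K ih =>
      intro i hi
      rw [Finset.sum_range_succ']
      by_cases h : i = m
      · subst h
        simpa [hitWeight] using hm
      · refine le_trans ?_ (hf i hi h)
        simp only [hitWeight, h, if_false, add_zero]
        rw [← Summable.tsum_finsetSum (fun _ _ => ENNReal.summable), ← ENNReal.tsum_mul_right]
        refine ENNReal.tsum_le_tsum fun y => ?_
        by_cases hy : y ∈ s
        · rw [← Finset.mul_sum, mul_assoc]
          gcongr
          exact ih y hy
        · simp [hs i hi h y hy]
  rw [hitTotal, ← ENNReal.tsum_mul_right, ENNReal.tsum_eq_iSup_nat]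
  refine iSup_le fun K => ?_
  rw [← Finset.sum_mul]
  exact key K i hi

/-! ### Expectations along the embedded chain -/

/-- The kernel `P (i → y) E exp (-l τ)`, where `τ` is the waiting time in `i` before a jump
to `y`. -/
def Params.kernel (D : Params) (l : ℝ) (i y : ℕ) : ℝ≥0∞ :=
  ENNReal.ofReal (D.trans i y) *
    ∫⁻ x, ENNReal.ofReal (Real.exp (-(l * x))) ∂(D.wait (decide (y = i + 1)) i)

lemma holding_eq (w : Outcome) (k : ℕ) :
    w.holding k = w.2 (decide (w.1 (k + 1) = w.1 k + 1)) (w.1 k) k := by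
  unfold Outcome.holding
  split_ifs with h <;> simp [h]

lemma measurable_holding (k : ℕ) : Measurable fun w : Outcome => w.holding k := by
  have h2 : ∀ b, Measurable fun w : Outcome => w.2 b (w.1 k) k := by
    intro b
    have h1 : Measurable fun z : ℕ × Outcome => z.2.2 b z.1 k :=
      measurable_from_prod_countable_right fun i => by
        change Measurable fun w : Outcome => w.2 b i k
        fun_prop
    exact h1.comp (g := fun z : ℕ × Outcome => z.2.2 b z.1 k)
      (f := fun w : Outcome => (w.1 k, w)) (by fun_prop)
  unfold Outcome.holding
  refine Measurable.ite ?_ (h2 true) (h2 false)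
  exact measurableSet_eq_fun (by fun_prop) (by fun_prop)

lemma measurable_jumpTime (k : ℕ) : Measurable fun w : Outcome => w.jumpTime k := by
  unfold Outcome.jumpTime
  exact Finset.measurable_sum _ fun j _ => measurable_holding j

/-- The discount factor `exp (-l T_k)` at the time of the `k`-th jump. -/
def discount (l : ℝ) (k : ℕ) (w : Outcome) : ℝ≥0∞ :=
  ENNReal.ofReal (Real.exp (-(l * w.jumpTime k)))

lemma measurable_discount (l : ℝ) (k : ℕ) : Measurable (discount l k) := by
  have := measurable_jumpTime k
  unfold discount
  fun_prop

/-- The trajectories whose embedded chain starts with `x 0, …, x k`. -/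
def cylinder (x : ℕ → ℕ) (k : ℕ) : Set (ℕ → ℕ) := {y | ∀ j ≤ k, y j = x j}

lemma measurableSet_cylinder (x : ℕ → ℕ) (k : ℕ) : MeasurableSet (cylinder x k) := by
  have : cylinder x k = ⋂ j, ⋂ (_ : j ≤ k), (fun y : ℕ → ℕ => y j) ⁻¹' {x j} := by
    ext; simp [cylinder]
  rw [this]
  exact MeasurableSet.iInter fun j => MeasurableSet.iInter fun _ =>
    measurable_pi_apply j (measurableSet_singleton _)

variable {Ω : Type*} [MeasurableSpace Ω] {D : Params} {P : Measure Ω}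
  {W : Ω → Outcome} {n : ℕ}

lemma IsWalkFrom.measure_cylinder [IsProbabilityMeasure P] (h : IsWalkFrom D P W n)
    (x : ℕ → ℕ) (k : ℕ) :
    P {ω | (W ω).1 ∈ cylinder x k} =
      if x 0 = n then ∏ j ∈ Finset.range k, ENNReal.ofReal (D.trans (x j) (x (j + 1))) else 0 := by
  induction k with
  | zero =>
    simp only [cylinder, Set.mem_ofPred_eq, Nat.le_zero, forall_eq, Finset.range_zero,
      Finset.prod_empty]
    split_ifs with hx
    · rw [← measure_univ (μ := P)]
      refine measure_congr ?_
      filter_upwards [h.initial] with ω hω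
      exact propext ⟨fun _ => trivial, fun _ => hω.trans hx.symm⟩
    · refine measure_mono_null (t := {ω | ¬ (W ω).1 0 = n}) ?_ (ae_iff.1 h.initial)
      intro ω hω h'
      exact hx (hω.symm.trans h')
  | succ k ih =>
    have := h.markov k x
    simp only [cylinder, Set.mem_ofPred_eq] at ih ⊢
    rw [this, ih, Finset.prod_range_succ]
    split_ifs <;> simp

lemma IsWalkFrom.lintegral_wait (h : IsWalkFrom D P W n) (l : ℝ) (b : Bool) (i k : ℕ) :
    ∫⁻ ω, ENNReal.ofReal (Real.exp (-(l * (W ω).2 b i k))) ∂P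
      = ∫⁻ x, ENNReal.ofReal (Real.exp (-(l * x))) ∂(D.wait b i) := by
  have hm := h.measurable
  rw [← h.law b i k, lintegral_map (by fun_prop) (by fun_prop)]

/-- On a given initial piece of the path of the chain, the discount factor is a product of
functions of distinct waiting times, so its expectation is a product of kernel entries. -/
lemma IsWalkFrom.lintegral_cylinder [IsProbabilityMeasure P] (h : IsWalkFrom D P W n)
    (l : ℝ) (x : ℕ → ℕ) (k : ℕ) :
    ∫⁻ ω, (cylinder x k).indicator 1 (W ω).1 * discount l k (W ω) ∂P =
      if x 0 = n then ∏ j ∈ Finset.range k, D.kernel l (x j) (x (j + 1)) else 0 := by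
  have hm := h.measurable
  -- The labels of the waiting times used along `x`; they are distinct, as the last entry is `j`.
  let c : ℕ → Bool × ℕ × ℕ := fun j => (decide (x (j + 1) = x j + 1), x j, j)
  have hc : c.Injective := fun a b hab => congrArg (fun z : Bool × ℕ × ℕ => z.2.2) hab
  let g : (Bool → ℕ → ℕ → ℝ) → ℝ≥0∞ := fun v =>
    ∏ j ∈ Finset.range k, ENNReal.ofReal (Real.exp (-(l * v (c j).1 (c j).2.1 (c j).2.2)))
  have hg : Measurable g := by
    refine Finset.measurable_prod _ fun j _ => ?_
    fun_prop
  have e1 : ∀ ω, (cylinder x k).indicator 1 (W ω).1 * discount l k (W ω)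
      = (cylinder x k).indicator 1 (W ω).1 * g (W ω).2 := by
    intro ω
    by_cases hω : (W ω).1 ∈ cylinder x k
    · congr 1
      simp only [discount, g, Outcome.jumpTime]
      rw [Finset.mul_sum, ← Finset.sum_neg_distrib, Real.exp_sum,
        ENNReal.ofReal_prod_of_nonneg fun _ _ => (Real.exp_pos _).le]
      refine Finset.prod_congr rfl fun j hj => ?_
      have hj := Finset.mem_range.1 hj
      rw [holding_eq, hω j (by omega), hω (j + 1) (by omega)]
    · simp [hω]
  have hind : IndepFun (fun ω => (cylinder x k).indicator (1 : (ℕ → ℕ) → ℝ≥0∞) (W ω).1)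
      (fun ω => g (W ω).2) P :=
    h.indep_chain.comp (measurable_one.indicator (measurableSet_cylinder x k)) hg
  simp_rw [e1]
  rw [lintegral_mul_eq_lintegral_mul_lintegral_of_indepFun'' _ _ hind]
  rotate_left
  · exact ((measurable_one.indicator (measurableSet_cylinder x k)).comp
      (measurable_fst.comp hm)).aemeasurable
  · exact (hg.comp (measurable_snd.comp hm)).aemeasurable
  have e2 : ∫⁻ ω, (cylinder x k).indicator (1 : (ℕ → ℕ) → ℝ≥0∞) (W ω).1 ∂P
      = P {ω | (W ω).1 ∈ cylinder x k} := by
    rw [← lintegral_indicator_one]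
    · rfl
    · exact (measurable_fst.comp hm) (measurableSet_cylinder x k)
  have e3 : ∫⁻ ω, g (W ω).2 ∂P = ∏ j ∈ Finset.range k,
      ∫⁻ y, ENNReal.ofReal (Real.exp (-(l * y))) ∂(D.wait (c j).1 (c j).2.1) := by
    have hi := (h.indep_wait.precomp hc).comp
      (fun _ y => ENNReal.ofReal (Real.exp (-(l * y)))) (fun _ => by fun_prop)
    have := lintegral_prod_eq_prod_lintegral_of_indepFun (Finset.range k) _ hi
      (fun j => by simp only [Function.comp_def]; fun_prop)
    refine this.trans (Finset.prod_congr rfl fun j _ => ?_)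
    exact h.lintegral_wait l _ _ _
  rw [e2, e3, h.measure_cylinder]
  split_ifs
  · rw [← Finset.prod_mul_distrib]
    rfl
  · simp

/-- The paths which, from step `r` on, visit `m` at step `N` for the first time. -/
def firstVisit (m r N : ℕ) : Set (ℕ → ℕ) := {y | y N = m ∧ ∀ j, r ≤ j → j < N → y j ≠ m}

lemma measurableSet_firstVisit (m r N : ℕ) : MeasurableSet (firstVisit m r N) := by
  have : firstVisit m r N = (fun y : ℕ → ℕ => y N) ⁻¹' {m} ∩
      ⋂ j, ⋂ (_ : r ≤ j), ⋂ (_ : j < N), (fun y : ℕ → ℕ => y j) ⁻¹' {m}ᶜ := by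
    ext; simp [firstVisit]
  rw [this]
  refine MeasurableSet.inter (measurable_pi_apply N (measurableSet_singleton _)) ?_
  exact MeasurableSet.iInter fun j => MeasurableSet.iInter fun _ => MeasurableSet.iInter fun _ =>
    measurable_pi_apply j (measurableSet_singleton _).compl

/-- The Markov property at step `r`, in the form of a sum over all continuations of the path. -/
lemma IsWalkFrom.lintegral_cylinder_inter_firstVisit [IsProbabilityMeasure P]
    (h : IsWalkFrom D P W n) (l : ℝ) (m k : ℕ) :
    ∀ (r N : ℕ) (x : ℕ → ℕ), r + k = N →
    ∫⁻ ω, (cylinder x r ∩ firstVisit m r N).indicator 1 (W ω).1 * discount l N (W ω) ∂P =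
      (if x 0 = n then ∏ j ∈ Finset.range r, D.kernel l (x j) (x (j + 1)) else 0)
        * hitWeight (D.kernel l) m k (x r) := by
  have hm := h.measurable
  induction k with
  | zero =>
    rintro r N x rfl
    simp only [hitWeight, add_zero]
    split_ifs with h1 h2 h2
    all_goals first
      | rw [mul_one]
        have : cylinder x r ∩ firstVisit m r r = cylinder x r := by
          refine Set.inter_eq_left.2 fun y hy => ⟨(hy r le_rfl).trans h2, fun j _ _ => by omega⟩
        rw [this, h.lintegral_cylinder]
        simp [h1]
      | have : cylinder x r ∩ firstVisit m r r = ∅ := by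
          refine Set.eq_empty_of_forall_notMem fun y hy => h2 ?_
          rw [← hy.1 r le_rfl]
          exact hy.2.1
        simp [this]
  | succ k ih =>
    rintro r N x hN
    by_cases h1 : x r = m
    · have : cylinder x r ∩ firstVisit m r N = ∅ := by
        refine Set.eq_empty_of_forall_notMem fun y hy => hy.2.2 r le_rfl (by omega) ?_
        rw [hy.1 r le_rfl, h1]
      simp [this, hitWeight, h1]
    · let x' : ℕ → ℕ → ℕ := fun y => Function.update x (r + 1) y
      have hx' : ∀ y j, j ≤ r → x' y j = x j := fun y j hj =>
        Function.update_of_ne (by omega) _ _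
      have hx1 : ∀ y, x' y (r + 1) = y := fun y => Function.update_self _ _ _
      have hmem : ∀ y z, z ∈ cylinder (x' y) (r + 1) ↔ z ∈ cylinder x r ∧ z (r + 1) = y := by
        intro y z
        constructor
        · exact fun hz => ⟨fun j hj => (hz j (by omega)).trans (hx' y j hj),
            (hz (r + 1) le_rfl).trans (hx1 y)⟩
        · rintro ⟨hz, hz1⟩ j hj
          rcases Nat.lt_or_ge r j with hj' | hj'
          · obtain rfl : j = r + 1 := by omega
            rw [hz1, hx1]
          · rw [hz j hj', hx' y j hj']
      have hfv : ∀ z ∈ cylinder x r, z ∈ firstVisit m r N ↔ z ∈ firstVisit m (r + 1) N := by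
        intro z hz
        refine and_congr_right fun _ => ⟨fun H j hj hj' => H j (by omega) hj', fun H j hj hj' => ?_⟩
        rcases Nat.lt_or_ge r j with h' | h'
        · exact H j h' hj'
        · obtain rfl : j = r := by omega
          rw [hz j le_rfl]
          exact h1
      have e1 : ∀ z : ℕ → ℕ, (cylinder x r ∩ firstVisit m r N).indicator (1 : (ℕ → ℕ) → ℝ≥0∞) z =
          ∑' y, (cylinder (x' y) (r + 1) ∩ firstVisit m (r + 1) N).indicator 1 z := by
        intro z
        rw [tsum_eq_single (z (r + 1))]
        · have : z ∈ cylinder x r ∩ firstVisit m r N ↔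
              z ∈ cylinder (x' (z (r + 1))) (r + 1) ∩ firstVisit m (r + 1) N := by
            rw [Set.mem_inter_iff, Set.mem_inter_iff, hmem]
            constructor
            · exact fun H => ⟨⟨H.1, rfl⟩, (hfv z H.1).1 H.2⟩
            · exact fun H => ⟨H.1.1, (hfv z H.1.1).2 H.2⟩
          by_cases hz : z ∈ cylinder x r ∩ firstVisit m r N
          · rw [Set.indicator_of_mem hz, Set.indicator_of_mem (this.1 hz)]
          · rw [Set.indicator_of_notMem hz, Set.indicator_of_notMem (fun h => hz (this.2 h))]
        · intro y hy
          refine Set.indicator_of_notMem (fun hz => hy ?_) _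
          exact ((hmem y z).1 hz.1).2.symm
      simp_rw [e1, ← ENNReal.tsum_mul_right]
      rw [lintegral_tsum]
      · rw [hitWeight, if_neg h1, ← ENNReal.tsum_mul_left]
        refine tsum_congr fun y => ?_
        rw [ih (r + 1) N (x' y) (by omega), hx' y 0 (by omega), hx1 y, Finset.prod_range_succ,
          hx1 y, hx' y r le_rfl]
        rw [Finset.prod_congr rfl (g := fun j => D.kernel l (x j) (x (j + 1)))]
        · split_ifs <;> ring
        · intro j hj
          have hj := Finset.mem_range.1 hj
          rw [hx' y j (by omega), hx' y (j + 1) (by omega)]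
      · intro y
        refine ((Measurable.mul ?_ ((measurable_discount l N).comp hm))).aemeasurable
        exact (measurable_one.indicator ((measurableSet_cylinder _ _).inter
          (measurableSet_firstVisit _ _ _))).comp (measurable_fst.comp hm)

lemma IsWalkFrom.lintegral_firstVisit [IsProbabilityMeasure P] (h : IsWalkFrom D P W n)
    (l : ℝ) (m k : ℕ) :
    ∫⁻ ω, (firstVisit m 0 k).indicator 1 (W ω).1 * discount l k (W ω) ∂P =
      hitWeight (D.kernel l) m k n := by
  have := h.lintegral_cylinder_inter_firstVisit l m k 0 k (fun _ => n) (by omega)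
  simp only [Finset.range_zero, Finset.prod_empty, if_true, one_mul] at this
  rw [← this]
  refine lintegral_congr_ae ?_
  filter_upwards [h.initial] with ω hω
  congr 1
  refine Set.indicator_eq_indicator ?_ rfl
  rw [Set.mem_inter_iff]
  exact ⟨fun H => ⟨fun j hj => by rw [Nat.le_zero.1 hj, hω], H⟩, fun H => H.2⟩

end CTRW

namespace CTRW

/-! ### Laplace transforms of hitting times -/

/-- The function `t ↦ exp (-l t)` on `[0, ∞]`, with the value `0` at `∞` for every `l`; for
`l = 0` it is the indicator of `t < ∞`. -/
def expNeg (l : ℝ) (t : ℝ≥0∞) : ℝ≥0∞ :=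
  if t = ∞ then 0 else ENNReal.ofReal (Real.exp (-(l * t.toReal)))

lemma expNeg_top (l : ℝ) : expNeg l ∞ = 0 := if_pos rfl

lemma expNeg_of_ne_top (l : ℝ) {t : ℝ≥0∞} (h : t ≠ ∞) :
    expNeg l t = ENNReal.ofReal (Real.exp (-(l * t.toReal))) := if_neg h

lemma measurable_expNeg (l : ℝ) : Measurable (expNeg l) := by
  unfold expNeg
  exact Measurable.ite (measurableSet_singleton _) measurable_const (by fun_prop)

lemma expNeg_le_one {l : ℝ} (hl : 0 ≤ l) (t : ℝ≥0∞) : expNeg l t ≤ 1 := by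
  unfold expNeg
  split_ifs
  · exact zero_le
  · rw [ENNReal.ofReal_le_one, Real.exp_le_one_iff]
    have := mul_nonneg hl (ENNReal.toReal_nonneg (a := t))
    linarith

lemma expNeg_zero (l : ℝ) : expNeg l 0 = 1 := by simp [expNeg]

lemma expNeg_add (l : ℝ) (s t : ℝ≥0∞) : expNeg l (s + t) = expNeg l s * expNeg l t := by
  by_cases hs : s = ∞
  · simp [hs, expNeg_top]
  by_cases ht : t = ∞
  · simp [ht, expNeg_top]
  rw [expNeg_of_ne_top l hs, expNeg_of_ne_top l ht, expNeg_of_ne_top l (by simp [hs, ht]),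
    ENNReal.toReal_add hs ht, ← ENNReal.ofReal_mul (Real.exp_pos _).le, ← Real.exp_add]
  congr 2
  ring

lemma expNeg_sum (l : ℝ) {ι : Type*} (s : Finset ι) (t : ι → ℝ≥0∞) :
    expNeg l (∑ i ∈ s, t i) = ∏ i ∈ s, expNeg l (t i) := by
  classical
  induction s using Finset.induction_on with
  | empty => simp [expNeg_zero]
  | insert a s ha ih => rw [Finset.sum_insert ha, Finset.prod_insert ha, expNeg_add, ih]

lemma expNeg_anti {l : ℝ} (hl : 0 ≤ l) {s t : ℝ≥0∞} (h : s ≤ t) : expNeg l t ≤ expNeg l s := by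
  obtain ⟨u, rfl⟩ := exists_add_of_le h
  rw [expNeg_add]
  exact mul_le_of_le_one_right zero_le (expNeg_le_one hl u)

/-- The first moment of a jump at which the chain is in `m`. -/
def firstJumpTime (w : Outcome) (m : ℕ) : ℝ≥0∞ :=
  ⨅ k, if w.1 k = m then ENNReal.ofReal (w.jumpTime k) else ∞

lemma measurable_firstJumpTime (m : ℕ) : Measurable fun w : Outcome => firstJumpTime w m := by
  unfold firstJumpTime
  refine Measurable.iInf fun k => Measurable.ite ?_ ?_ measurable_const
  · exact measurableSet_eq_fun (by fun_prop) (by fun_prop)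
  · exact (measurable_jumpTime k).ennreal_ofReal

section Path

variable {w : Outcome}

lemma jumpTime_strictMono (hw : ∀ k, 0 < w.holding k) : StrictMono w.jumpTime :=
  strictMono_nat_of_lt_succ fun k => by
    simpa [Outcome.jumpTime, Finset.sum_range_succ] using hw k

lemma jumpTime_nonneg (hw : ∀ k, 0 < w.holding k) (k : ℕ) : 0 ≤ w.jumpTime k :=
  Finset.sum_nonneg fun j _ => (hw j).le

lemma state_eq_some_iff (hw : ∀ k, 0 < w.holding k) (t : ℝ≥0) (m : ℕ) :
    w.state t = some m ↔
      ∃ k, (w.jumpTime k ≤ (t : ℝ) ∧ (t : ℝ) < w.jumpTime (k + 1)) ∧ w.1 k = m := by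
  classical
  unfold Outcome.state
  split_ifs with h
  · rw [Option.some_inj]
    constructor
    · exact fun hm => ⟨_, Nat.find_spec h, hm⟩
    · rintro ⟨k, hk, rfl⟩
      have hf := Nat.find_spec h
      have h1 := (jumpTime_strictMono hw).lt_iff_lt.1 (hk.1.trans_lt hf.2)
      have h2 := (jumpTime_strictMono hw).lt_iff_lt.1 (hf.1.trans_lt hk.2)
      exact congrArg w.1 (by omega)
  · simp only [false_iff]
    rintro ⟨k, hk, -⟩
    exact h ⟨k, hk⟩

/-- With positive waiting times the trajectory enters a state only at moments of jumps. -/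
lemma hittingTime_eq_firstJumpTime (hw : ∀ k, 0 < w.holding k) (m : ℕ) :
    w.hittingTime m = firstJumpTime w m := by
  refine le_antisymm (le_iInf fun k => ?_) (le_iInf₂ fun t ht => ?_)
  · split_ifs with h
    · refine iInf₂_le_of_le (w.jumpTime k).toNNReal ?_ le_rfl
      rw [state_eq_some_iff hw]
      refine ⟨k, ?_, h⟩
      rw [Real.coe_toNNReal _ (jumpTime_nonneg hw k)]
      exact ⟨le_rfl, jumpTime_strictMono hw (Nat.lt_succ_self k)⟩
    · exact le_top
  · obtain ⟨k, hk, hm⟩ := (state_eq_some_iff hw t m).1 ht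
    refine iInf_le_of_le k ?_
    rw [if_pos hm, ← ENNReal.ofReal_coe_nnreal]
    exact ENNReal.ofReal_le_ofReal hk.1

lemma expNeg_firstJumpTime (hw : ∀ k, 0 < w.holding k) (l : ℝ) (m : ℕ) :
    expNeg l (firstJumpTime w m) =
      ∑' k, (firstVisit m 0 k).indicator 1 w.1 * discount l k w := by
  classical
  by_cases h : ∃ k, w.1 k = m
  · have hf := Nat.find_spec h
    have hlt : ∀ j < Nat.find h, w.1 j ≠ m := fun j hj => Nat.find_min h hj
    have e : firstJumpTime w m = ENNReal.ofReal (w.jumpTime (Nat.find h)) := by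
      refine le_antisymm (iInf_le_of_le (Nat.find h) (by rw [if_pos hf])) (le_iInf fun k => ?_)
      split_ifs with hk
      · exact ENNReal.ofReal_le_ofReal
          ((jumpTime_strictMono hw).monotone (Nat.find_min' h hk))
      · exact le_top
    rw [tsum_eq_single (Nat.find h), Set.indicator_of_mem, e,
      expNeg_of_ne_top l ENNReal.ofReal_ne_top, ENNReal.toReal_ofReal (jumpTime_nonneg hw _)]
    · simp [discount]
    · exact ⟨hf, fun j _ => hlt j⟩
    · intro k hk
      rw [Set.indicator_of_notMem, zero_mul]
      rintro ⟨h1, h2⟩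
      rcases lt_or_gt_of_ne hk with hk | hk
      · exact hlt k hk h1
      · exact h2 _ zero_le hk hf
  · push Not at h
    have e : firstJumpTime w m = ∞ := by
      simp [firstJumpTime, h]
    rw [e, expNeg_top, eq_comm, ENNReal.tsum_eq_zero]
    intro k
    rw [Set.indicator_of_notMem, zero_mul]
    exact fun H => h k H.1

end Path

variable {Ω : Type*} [MeasurableSpace Ω] {D : Params} {P : Measure Ω}
  {W : Ω → Outcome} {n : ℕ}

lemma IsWalkFrom.ae_holding_pos (h : IsWalkFrom D P W n) : ∀ᵐ ω ∂P, ∀ k, 0 < (W ω).holding k := by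
  have hm := h.measurable
  have h1 : ∀ b i k, ∀ᵐ ω ∂P, 0 < (W ω).2 b i k := fun b i k => by
    have := D.wait_pos b i
    rw [← h.law b i k] at this
    exact ae_of_ae_map (by fun_prop) this
  have h2 : ∀ᵐ ω ∂P, ∀ b i k, 0 < (W ω).2 b i k := by
    simp_rw [ae_all_iff]
    exact h1
  filter_upwards [h2] with ω hω k
  rw [holding_eq]
  exact hω _ _ _

lemma IsWalkFrom.ae_hittingTime (h : IsWalkFrom D P W n) :
    ∀ᵐ ω ∂P, ∀ m, (W ω).hittingTime m = firstJumpTime (W ω) m := by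
  filter_upwards [h.ae_holding_pos] with ω hω m
  exact hittingTime_eq_firstJumpTime hω m

lemma IsWalkFrom.lintegral_expNeg [IsProbabilityMeasure P] (h : IsWalkFrom D P W n)
    (l : ℝ) (m : ℕ) :
    ∫⁻ ω, expNeg l (firstJumpTime (W ω) m) ∂P = hitTotal (D.kernel l) m n := by
  have hm := h.measurable
  have e : ∫⁻ ω, expNeg l (firstJumpTime (W ω) m) ∂P =
      ∫⁻ ω, ∑' k, (firstVisit m 0 k).indicator 1 (W ω).1 * discount l k (W ω) ∂P := by
    refine lintegral_congr_ae ?_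
    filter_upwards [h.ae_holding_pos] with ω hω
    exact expNeg_firstJumpTime hω l m
  rw [e, lintegral_tsum]
  · exact tsum_congr fun k => h.lintegral_firstVisit l m k
  · intro k
    refine ((Measurable.mul ?_ ((measurable_discount l k).comp hm))).aemeasurable
    exact (measurable_one.indicator (measurableSet_firstVisit _ _ _)).comp (measurable_fst.comp hm)

end CTRW

namespace CTRW

/-! ### The discounted birth-and-death kernel -/

namespace Params

variable (D : Params)

/-- `p_i E exp (-l τ⁺_i)`. -/
def up (l : ℝ) (i : ℕ) : ℝ := D.p i * ∫ x, Real.exp (-(l * x)) ∂(D.wait true i)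

/-- `q_i E exp (-l τ⁻_i)`. -/
def down (l : ℝ) (i : ℕ) : ℝ := D.q i * ∫ x, Real.exp (-(l * x)) ∂(D.wait false i)

lemma p_nonneg (i : ℕ) : 0 ≤ D.p i := by
  rcases Nat.eq_zero_or_pos i with rfl | h
  · simp [D.p_zero]
  · exact (D.p_pos i h).le

lemma q_nonneg (i : ℕ) : 0 ≤ D.q i := by
  rcases Nat.eq_zero_or_pos i with rfl | h
  · simp [D.q_zero]
  · exact (D.q_pos i h).le

lemma p_add_q_eq_one (i : ℕ) : D.p i + D.q i = 1 := by
  rcases Nat.eq_zero_or_pos i with rfl | h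
  · simp [D.p_zero, D.q_zero]
  · exact D.p_add_q i h

variable {l : ℝ}

lemma ae_exp_le_one (hl : 0 ≤ l) (b : Bool) (i : ℕ) :
    ∀ᵐ x ∂(D.wait b i), Real.exp (-(l * x)) ≤ 1 := by
  filter_upwards [D.wait_pos b i] with x hx
  rw [Real.exp_le_one_iff]
  nlinarith

lemma integrable_exp (hl : 0 ≤ l) (b : Bool) (i : ℕ) :
    Integrable (fun x => Real.exp (-(l * x))) (D.wait b i) := by
  have := D.wait_prob b i
  refine Integrable.of_bound (C := 1) (by fun_prop) ?_
  filter_upwards [D.ae_exp_le_one hl b i] with x hx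
  rwa [Real.norm_of_nonneg (Real.exp_pos _).le]

lemma integral_exp_pos (hl : 0 ≤ l) (b : Bool) (i : ℕ) :
    0 < ∫ x, Real.exp (-(l * x)) ∂(D.wait b i) := by
  have := D.wait_prob b i
  exact MeasureTheory.integral_exp_pos (D.integrable_exp hl b i)

lemma integral_exp_le_one (hl : 0 ≤ l) (b : Bool) (i : ℕ) :
    ∫ x, Real.exp (-(l * x)) ∂(D.wait b i) ≤ 1 := by
  have := D.wait_prob b i
  calc ∫ x, Real.exp (-(l * x)) ∂(D.wait b i) ≤ ∫ _, (1 : ℝ) ∂(D.wait b i) :=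
        integral_mono_ae (D.integrable_exp hl b i) (integrable_const _) (D.ae_exp_le_one hl b i)
    _ = 1 := by simp

lemma up_nonneg (hl : 0 ≤ l) (i : ℕ) : 0 ≤ D.up l i :=
  mul_nonneg (D.p_nonneg i) (D.integral_exp_pos hl true i).le

lemma down_nonneg (hl : 0 ≤ l) (i : ℕ) : 0 ≤ D.down l i :=
  mul_nonneg (D.q_nonneg i) (D.integral_exp_pos hl false i).le

lemma down_pos (hl : 0 ≤ l) {i : ℕ} (hi : 1 ≤ i) : 0 < D.down l i :=
  mul_pos (D.q_pos i hi) (D.integral_exp_pos hl false i)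

lemma up_le (hl : 0 ≤ l) (i : ℕ) : D.up l i ≤ D.p i :=
  mul_le_of_le_one_right (D.p_nonneg i) (D.integral_exp_le_one hl true i)

lemma down_le (hl : 0 ≤ l) (i : ℕ) : D.down l i ≤ D.q i :=
  mul_le_of_le_one_right (D.q_nonneg i) (D.integral_exp_le_one hl false i)

lemma up_zero (i : ℕ) : D.up 0 i = D.p i := by
  have := D.wait_prob true i
  simp [up]

lemma down_zero (i : ℕ) : D.down 0 i = D.q i := by
  have := D.wait_prob false i
  simp [down]

lemma up_add_down_one (i : ℕ) : D.up 1 i + D.down 1 i = D.laplace i := by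
  simp [up, down, laplace]

lemma kernel_up (hl : 0 ≤ l) (i : ℕ) : D.kernel l i (i + 1) = ENNReal.ofReal (D.up l i) := by
  rw [kernel, up, ENNReal.ofReal_mul (D.p_nonneg i),
    ofReal_integral_eq_lintegral_ofReal (D.integrable_exp hl true i)
      (Eventually.of_forall fun _ => (Real.exp_pos _).le)]
  simp [trans]

lemma kernel_down (hl : 0 ≤ l) (i : ℕ) :
    D.kernel l (i + 1) i = ENNReal.ofReal (D.down l (i + 1)) := by
  rw [kernel, down, ENNReal.ofReal_mul (D.q_nonneg _),
    ofReal_integral_eq_lintegral_ofReal (D.integrable_exp hl false _)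
      (Eventually.of_forall fun _ => (Real.exp_pos _).le)]
  have h : i ≠ i + 1 + 1 := by omega
  simp [trans, h]

lemma kernel_eq_zero {i y : ℕ} (h1 : y ≠ i + 1) (h2 : y + 1 ≠ i) : D.kernel l i y = 0 := by
  simp [kernel, trans, h1, h2]

lemma tsum_kernel (hl : 0 ≤ l) (i : ℕ) (f : ℕ → ℝ≥0∞) :
    ∑' y, D.kernel l (i + 1) y * f y =
      ENNReal.ofReal (D.up l (i + 1)) * f (i + 2) + ENNReal.ofReal (D.down l (i + 1)) * f i := by
  rw [tsum_eq_sum (s := {i + 2, i})]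
  · rw [Finset.sum_pair (by omega), ← D.kernel_up hl, ← D.kernel_down hl]
  · intro y hy
    simp only [Finset.mem_insert, Finset.mem_singleton, not_or] at hy
    rw [D.kernel_eq_zero (by omega) (by omega), zero_mul]

/-! ### Laplace transforms of first-passage times -/

/-- The Laplace transform at `l` of the hitting time of `m` for the walk started in `i`. -/
def hitLaplace (l : ℝ) (m i : ℕ) : ℝ≥0∞ := hitTotal (D.kernel l) m i

lemma hitLaplace_self (m : ℕ) : D.hitLaplace l m m = 1 := hitTotal_self _ m

lemma hitLaplace_step (hl : 0 ≤ l) {m i : ℕ} (hi : i + 1 ≠ m) :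
    D.hitLaplace l m (i + 1) = ENNReal.ofReal (D.up l (i + 1)) * D.hitLaplace l m (i + 2)
      + ENNReal.ofReal (D.down l (i + 1)) * D.hitLaplace l m i := by
  rw [hitLaplace, hitTotal_of_ne _ hi, D.tsum_kernel hl]
  rfl

/-- Minimality of `hitLaplace` among supersolutions above `m`. -/
lemma hitLaplace_mul_le (hl : 0 ≤ l) {m : ℕ} (c : ℝ≥0∞) (f : ℕ → ℝ≥0∞) (hm : c ≤ f m)
    (hf : ∀ i, m ≤ i → ENNReal.ofReal (D.up l (i + 1)) * f (i + 2)
      + ENNReal.ofReal (D.down l (i + 1)) * f i ≤ f (i + 1)) {i : ℕ} (hi : m ≤ i) :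
    D.hitLaplace l m i * c ≤ f i := by
  refine hitTotal_mul_le (D.kernel l) {i | m ≤ i} ?_ c f hm ?_ hi
  · intro i hi h y hy
    simp only [Set.mem_ofPred_eq, not_le] at hi hy
    exact D.kernel_eq_zero (by omega) (by omega)
  · intro i hi h
    simp only [Set.mem_ofPred_eq] at hi
    obtain ⟨i, rfl⟩ : ∃ j, i = j + 1 := ⟨i - 1, by omega⟩
    rw [D.tsum_kernel hl]
    exact hf i (by omega)

lemma hitLaplace_le_one (hl : 0 ≤ l) {m i : ℕ} (hi : m ≤ i) : D.hitLaplace l m i ≤ 1 := by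
  have := D.hitLaplace_mul_le hl 1 (fun _ => 1) le_rfl (fun j _ => ?_) hi
  · simpa using this
  · rw [mul_one, mul_one, ← ENNReal.ofReal_add (D.up_nonneg hl _) (D.down_nonneg hl _),
      ENNReal.ofReal_le_one]
    linarith [D.up_le hl (j + 1), D.down_le hl (j + 1), D.p_add_q_eq_one (j + 1)]

/-- The strong Markov property at the hitting time of `m`, in terms of Laplace transforms: the
walk has to pass through `m` on its way down to `0`. -/
lemma hitLaplace_mul (hl : 0 ≤ l) {m i : ℕ} (hi : m ≤ i) :
    D.hitLaplace l 0 i = D.hitLaplace l m i * D.hitLaplace l 0 m := by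
  have ge : ∀ i, m ≤ i → D.hitLaplace l m i * D.hitLaplace l 0 m ≤ D.hitLaplace l 0 i :=
    fun i hi => D.hitLaplace_mul_le hl _ _ le_rfl
      (fun j _ => (D.hitLaplace_step hl (by omega)).ge) hi
  refine le_antisymm ?_ (ge i hi)
  -- The right-hand side above `m`, continued by the left-hand side below `m`, is a supersolution
  -- for the passage to `0`: at `m` itself because of `ge`.
  let F : ℕ → ℝ≥0∞ := fun i =>
    if m ≤ i then D.hitLaplace l m i * D.hitLaplace l 0 m else D.hitLaplace l 0 i
  have hF : ∀ i, i ≤ m → F i = D.hitLaplace l 0 i := by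
    intro i hi
    rcases hi.lt_or_eq with h | rfl
    · simp [F, not_le.2 h]
    · simp [F, hitLaplace_self]
  have hF' : ∀ i, m ≤ i → F i = D.hitLaplace l m i * D.hitLaplace l 0 m := by
    intro i hi
    simp [F, hi]
  have hFle : ∀ i, F i ≤ D.hitLaplace l 0 i := by
    intro i
    rcases le_total i m with h | h
    · exact (hF i h).le
    · exact (hF' i h).trans_le (ge i h)
  have := D.hitLaplace_mul_le hl 1 F (by rw [hF 0 (Nat.zero_le _), hitLaplace_self])
    (fun j _ => ?_) (Nat.zero_le i)
  · rwa [mul_one, hF' i hi] at this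
  · rcases Nat.lt_or_ge m (j + 1) with h | h
    · rw [hF' _ (by omega : m ≤ j), hF' _ (by omega : m ≤ j + 1), hF' _ (by omega : m ≤ j + 2),
        D.hitLaplace_step hl (m := m) (i := j) (by omega)]
      exact le_of_eq (by ring)
    · rw [hF _ h, D.hitLaplace_step hl (m := 0) (by omega)]
      gcongr
      · exact hFle _
      · exact hFle _

/-- The Laplace transform at `l` of the hitting time of `0` for the walk started in `i`, as a
real number. -/
def toZero (l : ℝ) (i : ℕ) : ℝ := (D.hitLaplace l 0 i).toReal

lemma ofReal_toZero (hl : 0 ≤ l) (i : ℕ) : ENNReal.ofReal (D.toZero l i) = D.hitLaplace l 0 i :=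
  ENNReal.ofReal_toReal ((D.hitLaplace_le_one hl (Nat.zero_le i)).trans_lt ENNReal.one_lt_top).ne

lemma toZero_zero : D.toZero l 0 = 1 := by simp [toZero, hitLaplace_self]

lemma toZero_nonneg (i : ℕ) : 0 ≤ D.toZero l i := ENNReal.toReal_nonneg

lemma toZero_step (hl : 0 ≤ l) (i : ℕ) : D.toZero l (i + 1) =
    D.up l (i + 1) * D.toZero l (i + 2) + D.down l (i + 1) * D.toZero l i := by
  have h1 := mul_nonneg (D.up_nonneg hl (i + 1)) (D.toZero_nonneg (l := l) (i + 2))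
  have h2 := mul_nonneg (D.down_nonneg hl (i + 1)) (D.toZero_nonneg (l := l) i)
  rw [← ENNReal.toReal_ofReal (add_nonneg h1 h2), ENNReal.ofReal_add h1 h2,
    ENNReal.ofReal_mul (D.up_nonneg hl _), ENNReal.ofReal_mul (D.down_nonneg hl _),
    D.ofReal_toZero hl, D.ofReal_toZero hl, ← D.hitLaplace_step hl (by omega)]
  rfl

lemma toZero_antitone (hl : 0 ≤ l) : Antitone (D.toZero l) := by
  refine antitone_nat_of_succ_le fun i => ?_
  have hi : D.hitLaplace l 0 i ≠ ∞ :=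
    ((D.hitLaplace_le_one hl (Nat.zero_le i)).trans_lt ENNReal.one_lt_top).ne
  refine ENNReal.toReal_mono hi ?_
  rw [D.hitLaplace_mul hl (Nat.le_succ i)]
  exact mul_le_of_le_one_left zero_le (D.hitLaplace_le_one hl (Nat.le_succ i))

lemma toZero_pos (hl : 0 ≤ l) (i : ℕ) : 0 < D.toZero l i := by
  induction i with
  | zero => simp [toZero_zero]
  | succ i ih =>
    rw [D.toZero_step hl]
    have h1 := mul_nonneg (D.up_nonneg hl (i + 1)) (D.toZero_nonneg (l := l) (i + 2))
    have h2 := mul_pos (D.down_pos hl (Nat.le_add_left 1 i)) ih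
    linarith

/-- The Laplace transform of `σ_0` is the product of those of the passage times through the
intermediate levels. -/
lemma prod_hitLaplace (hl : 0 ≤ l) (N : ℕ) :
    ∏ j ∈ Finset.range N, D.hitLaplace l j (j + 1) = D.hitLaplace l 0 N := by
  induction N with
  | zero => simp [hitLaplace_self]
  | succ N ih => rw [Finset.prod_range_succ, ih, D.hitLaplace_mul hl (Nat.le_succ N), mul_comm]

end Params

end CTRW

namespace CTRW

namespace Params

/-! ### Scale and speed -/

variable (D : Params) {l : ℝ}

lemma scale_pos (k : ℕ) : 0 < D.scale k :=
  div_pos (Finset.prod_pos fun j hj => D.q_pos j (Finset.mem_Icc.1 hj).1)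
    (Finset.prod_pos fun j hj => D.p_pos j (Finset.mem_Icc.1 hj).1)

lemma scale_succ (k : ℕ) : D.p (k + 1) * D.scale (k + 1) = D.q (k + 1) * D.scale k := by
  have h1 : D.p (k + 1) ≠ 0 := (D.p_pos _ (by omega)).ne'
  have h2 : ∏ j ∈ Finset.Icc 1 k, D.p j ≠ 0 :=
    (Finset.prod_pos fun j hj => D.p_pos j (Finset.mem_Icc.1 hj).1).ne'
  rw [scale, scale, Finset.prod_Icc_succ_top (by omega), Finset.prod_Icc_succ_top (by omega)]
  field_simp

lemma speed_eq (k : ℕ) :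
    D.speed (k + 1) = (1 - D.laplace (k + 1)) / (D.q (k + 1) * D.scale k) := by
  have h1 : D.q (k + 1) ≠ 0 := (D.q_pos _ (by omega)).ne'
  have h2 : ∏ j ∈ Finset.Icc 1 k, D.p j ≠ 0 :=
    (Finset.prod_pos fun j hj => D.p_pos j (Finset.mem_Icc.1 hj).1).ne'
  have h3 : ∏ j ∈ Finset.Icc 1 k, D.q j ≠ 0 :=
    (Finset.prod_pos fun j hj => D.q_pos j (Finset.mem_Icc.1 hj).1).ne'
  have h4 : Finset.Ico 1 (k + 1) = Finset.Icc 1 k := by ext; simp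
  rw [speed, scale, Finset.prod_Icc_succ_top (by omega), h4]
  field_simp

/-- The analogue of `D.speed (k + 1)` for the Laplace transform at `l` in place of `1`. -/
def killing (l : ℝ) (k : ℕ) : ℝ :=
  (1 - (D.up l (k + 1) + D.down l (k + 1))) / (D.q (k + 1) * D.scale k)

lemma killing_one (k : ℕ) : D.killing 1 k = D.speed (k + 1) := by
  rw [killing, speed_eq, up_add_down_one]

lemma killing_zero (k : ℕ) : D.killing 0 k = 0 := by
  rw [killing, up_zero, down_zero, p_add_q_eq_one, sub_self, zero_div]

lemma killing_nonneg (hl : 0 ≤ l) (k : ℕ) : 0 ≤ D.killing l k := by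
  refine div_nonneg ?_ (mul_nonneg (D.q_nonneg _) (D.scale_pos k).le)
  linarith [D.up_le hl (k + 1), D.down_le hl (k + 1), D.p_add_q_eq_one (k + 1)]

/-- The decrease of `toZero` from `k` to `k + 1` per unit of scale. -/
def slope (l : ℝ) (k : ℕ) : ℝ := (D.toZero l k - D.toZero l (k + 1)) / D.scale k

lemma scale_mul_slope (k : ℕ) :
    D.scale k * D.slope l k = D.toZero l k - D.toZero l (k + 1) := by
  rw [slope, mul_div_cancel₀ _ (D.scale_pos k).ne']

lemma slope_nonneg (hl : 0 ≤ l) (k : ℕ) : 0 ≤ D.slope l k :=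
  div_nonneg (sub_nonneg.2 (D.toZero_antitone hl (Nat.le_succ k))) (D.scale_pos k).le

/-- The first-step equation for `toZero` as an equation for the increments of the slope. -/
lemma slope_sub_slope (hl : 0 ≤ l) (k : ℕ) : D.slope l k - D.slope l (k + 1) =
    ((D.p (k + 1) - D.up l (k + 1)) * D.toZero l (k + 2)
      + (D.q (k + 1) - D.down l (k + 1)) * D.toZero l k) / (D.q (k + 1) * D.scale k) := by
  have h1 := (D.scale_pos k).ne'
  have h2 := (D.q_pos (k + 1) (by omega)).ne'
  have h3 := (D.p_pos (k + 1) (by omega)).ne'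
  have hs : D.scale (k + 1) = D.q (k + 1) * D.scale k / D.p (k + 1) := by
    rw [eq_div_iff h3, mul_comm, scale_succ]
  have hq : D.q (k + 1) = 1 - D.p (k + 1) := by linarith [D.p_add_q_eq_one (k + 1)]
  rw [slope, slope, hs]
  have e : (D.toZero l (k + 1) - D.toZero l (k + 1 + 1)) / (D.q (k + 1) * D.scale k / D.p (k + 1))
      = D.p (k + 1) * (D.toZero l (k + 1) - D.toZero l (k + 2)) / (D.q (k + 1) * D.scale k) := by
    field_simp
  have e' : (D.toZero l k - D.toZero l (k + 1)) / D.scale k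
      = D.q (k + 1) * (D.toZero l k - D.toZero l (k + 1)) / (D.q (k + 1) * D.scale k) := by
    field_simp
  rw [e, e', ← sub_div]
  congr 1
  have := D.toZero_step hl k
  linear_combination (-1 : ℝ) * this - D.toZero l (k + 1) * D.p_add_q_eq_one (k + 1)

lemma killing_mul_le (hl : 0 ≤ l) (k : ℕ) :
    D.killing l k * D.toZero l (k + 2) ≤ D.slope l k - D.slope l (k + 1) := by
  rw [slope_sub_slope D hl, killing, div_mul_eq_mul_div]
  refine div_le_div_of_nonneg_right ?_ (mul_nonneg (D.q_nonneg _) (D.scale_pos k).le)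
  have := mul_le_mul_of_nonneg_left (D.toZero_antitone hl (by omega : k ≤ k + 2))
    (sub_nonneg.2 (D.down_le hl (k + 1)))
  have hp := D.p_add_q_eq_one (k + 1)
  rw [← hp]
  linarith

lemma le_killing_mul (hl : 0 ≤ l) (k : ℕ) :
    D.slope l k - D.slope l (k + 1) ≤ D.killing l k * D.toZero l k := by
  rw [slope_sub_slope D hl, killing, div_mul_eq_mul_div]
  refine div_le_div_of_nonneg_right ?_ (mul_nonneg (D.q_nonneg _) (D.scale_pos k).le)
  have := mul_le_mul_of_nonneg_left (D.toZero_antitone hl (by omega : k ≤ k + 2))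
    (sub_nonneg.2 (D.up_le hl (k + 1)))
  have hp := D.p_add_q_eq_one (k + 1)
  rw [← hp]
  linarith

/-- Only the nonnegativity of the slope at `k + J` is needed here, not its limit. -/
lemma sum_killing_le_slope (hl : 0 ≤ l) {c : ℝ} (hc : ∀ i, c ≤ D.toZero l i) (k J : ℕ) :
    c * ∑ j ∈ Finset.range J, D.killing l (k + j) ≤ D.slope l k := by
  have : c * ∑ j ∈ Finset.range J, D.killing l (k + j) + D.slope l (k + J) ≤ D.slope l k := by
    induction J with
    | zero => simp
    | succ J ih =>
      rw [Finset.sum_range_succ]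
      have h1 := D.killing_mul_le hl (k + J)
      have h2 := mul_le_mul_of_nonneg_left (hc (k + J + 2)) (D.killing_nonneg hl (k + J))
      rw [← add_assoc]
      linarith
  linarith [D.slope_nonneg hl (k + J)]

lemma slope_le_add_sum (hl : 0 ≤ l) (k J : ℕ) : D.slope l k ≤
    D.slope l (k + J) + D.toZero l k * ∑ j ∈ Finset.range J, D.killing l (k + j) := by
  induction J with
  | zero => simp
  | succ J ih =>
    rw [Finset.sum_range_succ]
    have h1 := D.le_killing_mul hl (k + J)
    have h2 := mul_le_mul_of_nonneg_left (D.toZero_antitone hl (Nat.le_add_right k J))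
      (D.killing_nonneg hl (k + J))
    rw [← add_assoc]
    linarith

lemma slope_antitone (hl : 0 ≤ l) : Antitone (D.slope l) :=
  antitone_nat_of_succ_le fun k => by
    have := mul_nonneg (D.killing_nonneg hl k) (D.toZero_nonneg (l := l) (k + 2))
    linarith [D.killing_mul_le hl k]

lemma sum_scale_mul_slope (n : ℕ) :
    ∑ k ∈ Finset.range n, D.scale k * D.slope l k = 1 - D.toZero l n := by
  simp_rw [scale_mul_slope]
  rw [Finset.sum_range_sub', toZero_zero]

lemma summable_scale_iff : Summable D.scale ↔ D.scaleSeries < ∞ := by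
  constructor
  · exact fun h => lt_top_iff_ne_top.2 h.tsum_ofReal_ne_top
  · intro h
    have := ENNReal.summable_toReal (f := fun k => ENNReal.ofReal (D.scale k)) h.ne
    simpa [ENNReal.toReal_ofReal (D.scale_pos _).le] using this

/-- If the scale is infinite, the bounded function `toZero` cannot have a slope bounded away
from zero. -/
lemma tendsto_slope (hl : 0 ≤ l) (h : D.scaleSeries = ∞) :
    Tendsto (D.slope l) atTop (𝓝 0) := by
  have hns : ¬ Summable D.scale := by rw [summable_scale_iff, h]; simp
  have ht := tendsto_atTop_ciInf (D.slope_antitone hl) ⟨0, by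
    rintro _ ⟨k, rfl⟩; exact D.slope_nonneg hl k⟩
  have h0 : 0 ≤ ⨅ k, D.slope l k := le_ciInf fun k => D.slope_nonneg hl k
  rcases h0.eq_or_lt with h0 | h0
  · rwa [← h0] at ht
  · refine absurd ?_ hns
    refine summable_of_sum_range_le (c := 1 / ⨅ k, D.slope l k)
      (fun k => (D.scale_pos k).le) fun n => ?_
    rw [le_div_iff₀ h0, Finset.sum_mul]
    calc ∑ k ∈ Finset.range n, D.scale k * ⨅ k, D.slope l k
        ≤ ∑ k ∈ Finset.range n, D.scale k * D.slope l k :=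
          Finset.sum_le_sum fun k _ => mul_le_mul_of_nonneg_left
            (ciInf_le ⟨0, by rintro _ ⟨k, rfl⟩; exact D.slope_nonneg hl k⟩ k) (D.scale_pos k).le
      _ ≤ 1 := by rw [sum_scale_mul_slope]; linarith [D.toZero_nonneg (l := l) n]

/-- If the scale is infinite, the walk hits `0` almost surely: for `l = 0` the slope is constant,
so it is equal to its limit `0`. -/
lemma toZero_zero_eq_one (h : D.scaleSeries = ∞) (i : ℕ) : D.toZero 0 i = 1 := by
  have h0 : ∀ k, D.slope 0 k = 0 := by
    intro k
    refine le_antisymm (ge_of_tendsto' (tendsto_slope D le_rfl h |>.comp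
      (tendsto_add_atTop_nat k)) fun J => ?_) (D.slope_nonneg le_rfl k)
    have := D.slope_le_add_sum le_rfl k J
    simpa [killing_zero, add_comm] using this
  have := D.sum_scale_mul_slope (l := 0) i
  simp only [h0, mul_zero, Finset.sum_const_zero] at this
  linarith

/-- If the scale is finite, the walk is transient, and `0` is hit with small probability from far
away. -/
lemma not_le_toZero_of_scale_lt_top (hl : 0 ≤ l) (h : D.scaleSeries < ∞) :
    ¬ ∃ c, 0 < c ∧ ∀ i, c ≤ D.toZero l i := by
  have hs := D.summable_scale_iff.2 h
  let R : ℕ → ℝ := fun i => ∑' k, D.scale (k + i)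
  have hR : ∀ i, R i = D.scale i + R (i + 1) := by
    intro i
    have := ((summable_nat_add_iff i).2 hs).tsum_eq_zero_add
    simpa [R, add_assoc, add_comm, add_left_comm] using this
  have hRn : ∀ i, 0 ≤ R i := fun i => tsum_nonneg fun k => (D.scale_pos _).le
  have hR0 : 0 < R 0 := by
    rw [hR 0]
    linarith [D.scale_pos 0, hRn 1]
  have hlim : Tendsto R atTop (𝓝 0) := tendsto_sum_nat_add D.scale
  -- The hitting probability of `0` from `i` is at most `R i / R 0`, a harmonic function.
  have hle : ∀ i, D.toZero l i ≤ R i / R 0 := by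
    intro i
    refine ENNReal.toReal_le_of_le_ofReal (div_nonneg (hRn i) hR0.le) ?_
    have := D.hitLaplace_mul_le hl (m := 0) 1 (fun i => ENNReal.ofReal (R i / R 0))
      (by simp [hR0.ne']) (fun j _ => ?_) (Nat.zero_le i)
    · simpa using this
    · rw [← ENNReal.ofReal_mul (D.up_nonneg hl _), ← ENNReal.ofReal_mul (D.down_nonneg hl _),
        ← ENNReal.ofReal_add (mul_nonneg (D.up_nonneg hl _) (div_nonneg (hRn _) hR0.le))
          (mul_nonneg (D.down_nonneg hl _) (div_nonneg (hRn _) hR0.le))]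
      refine ENNReal.ofReal_le_ofReal ?_
      have e : D.p (j + 1) * R (j + 2) + D.q (j + 1) * R j = R (j + 1) := by
        have h1 := hR j
        have h2 := hR (j + 1)
        have h3 := D.scale_succ j
        have h4 := D.p_add_q_eq_one (j + 1)
        linear_combination D.q (j + 1) * h1 - D.p (j + 1) * h2 - h3 + R (j + 1) * h4
      calc D.up l (j + 1) * (R (j + 2) / R 0) + D.down l (j + 1) * (R j / R 0)
          ≤ D.p (j + 1) * (R (j + 2) / R 0) + D.q (j + 1) * (R j / R 0) := by
            gcongr
            · exact div_nonneg (hRn _) hR0.le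
            · exact D.up_le hl _
            · exact div_nonneg (hRn _) hR0.le
            · exact D.down_le hl _
        _ = R (j + 1) / R 0 := by rw [← e]; ring
  rintro ⟨c, hc, hci⟩
  have h1 : c ≤ 0 / R 0 := ge_of_tendsto' (hlim.div_const (R 0)) fun i => (hci i).trans (hle i)
  simp only [zero_div] at h1
  linarith

/-- If the Laplace transforms of `σ_0` are bounded away from zero, then the increments of the
slope bound the inner sums of the series from above, and the total decrease of `toZero` bounds
the outer sum. -/
lemma implosionSeries_lt_top {c : ℝ} (hc : 0 < c) (h : ∀ i, c ≤ D.toZero 1 i) :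
    D.implosionSeries < ∞ := by
  have h1 : ∀ k, ENNReal.ofReal c * ∑' j, ENNReal.ofReal (D.speed (k + 1 + j)) ≤
      ENNReal.ofReal (D.slope 1 k) := by
    intro k
    rw [← ENNReal.tsum_mul_left, ENNReal.tsum_eq_iSup_nat]
    refine iSup_le fun J => ?_
    refine le_trans (le_of_eq ?_)
      (ENNReal.ofReal_le_ofReal (D.sum_killing_le_slope zero_le_one h k J))
    rw [ENNReal.ofReal_mul hc.le, ENNReal.ofReal_sum_of_nonneg
      fun j _ => D.killing_nonneg zero_le_one _, ← Finset.mul_sum]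
    congr 1
    refine Finset.sum_congr rfl fun j _ => ?_
    rw [killing_one, add_right_comm]
  have h2 : ENNReal.ofReal c * D.implosionSeries ≤ 1 := by
    rw [implosionSeries, ← ENNReal.tsum_mul_left, ENNReal.tsum_eq_iSup_nat]
    refine iSup_le fun n => ?_
    calc ∑ k ∈ Finset.range n, ENNReal.ofReal c *
          ((∑' j, ENNReal.ofReal (D.speed (k + 1 + j))) * ENNReal.ofReal (D.scale k))
        ≤ ∑ k ∈ Finset.range n, ENNReal.ofReal (D.scale k * D.slope 1 k) := by
          refine Finset.sum_le_sum fun k _ => ?_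
          rw [← mul_assoc, mul_comm (D.scale k), ENNReal.ofReal_mul (D.slope_nonneg zero_le_one k)]
          gcongr
          exact h1 k
      _ = ENNReal.ofReal (1 - D.toZero 1 n) := by
          rw [← ENNReal.ofReal_sum_of_nonneg fun k _ =>
            mul_nonneg (D.scale_pos k).le (D.slope_nonneg zero_le_one k), sum_scale_mul_slope]
      _ ≤ 1 := by
          rw [ENNReal.ofReal_le_one]
          linarith [D.toZero_nonneg (l := 1) n]
  by_contra hS
  rw [not_lt_top_iff] at hS
  rw [hS, ENNReal.mul_top (by simpa using hc)] at h2
  exact absurd h2 (by simp)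

/-- If the scale is infinite and the series converges, the relative decrease of `toZero` from `k`
to `k + 1` is bounded by the `k`-th term of the series, and so `toZero` stays away from zero. -/
lemma exists_le_toZero (hsc : D.scaleSeries = ∞) (hS : D.implosionSeries < ∞) :
    ∃ c, 0 < c ∧ ∀ i, c ≤ D.toZero 1 i := by
  let e : ℕ → ℝ := fun k =>
    ((∑' j : ℕ, ENNReal.ofReal (D.speed (k + 1 + j))) * ENNReal.ofReal (D.scale k)).toReal
  have he : Summable e := ENNReal.summable_toReal hS.ne
  have hk : ∀ k, D.toZero 1 k - D.toZero 1 (k + 1) ≤ D.toZero 1 k * e k := by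
    intro k
    have hfin : ∑' j : ℕ, ENNReal.ofReal (D.speed (k + 1 + j)) ≠ ∞ := by
      intro H
      refine ENNReal.ne_top_of_tsum_ne_top hS.ne k ?_
      rw [H, ENNReal.top_mul]
      simpa using D.scale_pos k
    have hslope : D.slope 1 k ≤
        D.toZero 1 k * (∑' j : ℕ, ENNReal.ofReal (D.speed (k + 1 + j))).toReal := by
      have hlim := (D.tendsto_slope zero_le_one hsc).comp (tendsto_add_atTop_nat k)
      have hlim' := hlim.add_const
        (D.toZero 1 k * (∑' j : ℕ, ENNReal.ofReal (D.speed (k + 1 + j))).toReal)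
      rw [zero_add] at hlim'
      refine ge_of_tendsto' hlim' fun J => ?_
      refine (D.slope_le_add_sum zero_le_one k J).trans ?_
      simp only [Function.comp_apply]
      rw [add_comm J k]
      gcongr
      · exact D.toZero_nonneg k
      · rw [← ENNReal.ofReal_le_iff_le_toReal hfin,
          ENNReal.ofReal_sum_of_nonneg fun j _ => D.killing_nonneg zero_le_one _]
        refine le_trans (le_of_eq ?_) (ENNReal.sum_le_tsum (Finset.range J))
        refine Finset.sum_congr rfl fun j _ => ?_
        rw [killing_one, add_right_comm]
    rw [← scale_mul_slope]
    simp only [e, ENNReal.toReal_mul, ENNReal.toReal_ofReal (D.scale_pos k).le]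
    nlinarith [mul_le_mul_of_nonneg_left hslope (D.scale_pos k).le]
  obtain ⟨K, hK⟩ := ((tendsto_sum_nat_add e).eventually
    (gt_mem_nhds (show (0 : ℝ) < 1 / 2 by norm_num))).exists
  have he0 : ∀ k, 0 ≤ e k := fun k => ENNReal.toReal_nonneg
  have hsum : ∀ n, D.toZero 1 K - D.toZero 1 (K + n) ≤
      D.toZero 1 K * ∑ j ∈ Finset.range n, e (j + K) := by
    intro n
    induction n with
    | zero => simp
    | succ n ih =>
      rw [Finset.sum_range_succ]
      have h1 := hk (K + n)
      have h2 := mul_le_mul_of_nonneg_right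
        (D.toZero_antitone zero_le_one (Nat.le_add_right K n)) (he0 (K + n))
      rw [add_comm n K, ← add_assoc]
      linarith
  refine ⟨D.toZero 1 K / 2, half_pos (D.toZero_pos zero_le_one K), fun i => ?_⟩
  refine le_trans ?_ (D.toZero_antitone zero_le_one (Nat.le_add_left i K))
  have h1 : ∑ j ∈ Finset.range i, e (j + K) ≤ 1 / 2 :=
    (((summable_nat_add_iff K).2 he).sum_le_tsum _ fun _ _ => he0 _).trans hK.le
  have h2 := mul_le_mul_of_nonneg_left h1 (D.toZero_nonneg (l := 1) K)
  linarith [hsum i]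

/-- The convergence condition in terms of the Laplace transforms of the hitting times of `0`. -/
lemma exists_le_toZero_iff :
    (∃ c, 0 < c ∧ ∀ i, c ≤ D.toZero 1 i) ↔ D.implosionSeries < ∞ ∧ D.scaleSeries = ∞ := by
  constructor
  · intro h
    refine ⟨?_, ?_⟩
    · obtain ⟨c, hc, hci⟩ := h
      exact D.implosionSeries_lt_top hc hci
    · by_contra hs
      exact D.not_le_toZero_of_scale_lt_top zero_le_one (lt_top_iff_ne_top.2 hs) h
  · exact fun h => D.exists_le_toZero h.2 h.1

end Params

end CTRW

namespace CTRW

/-! ### Sums of nonnegative extended random variables -/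

/-- Since `1 - exp (-t) ≥ t / (1 + t)`, the hypothesis forces `t ≤ 1`, and then
`1 - exp (-t) ≥ t / 2`. -/
lemma toReal_le_of_one_sub_expNeg_le {t : ℝ≥0∞} (ht : t ≠ ∞)
    (h : (1 - expNeg 1 t).toReal ≤ 1 / 2) : t.toReal ≤ 2 * (1 - expNeg 1 t).toReal := by
  have e : (1 - expNeg 1 t).toReal = 1 - Real.exp (-t.toReal) := by
    rw [ENNReal.toReal_sub_of_le (expNeg_le_one zero_le_one t) ENNReal.one_ne_top,
      expNeg_of_ne_top 1 ht, ENNReal.toReal_ofReal (Real.exp_pos _).le, one_mul,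
      ENNReal.toReal_one]
  rw [e] at h ⊢
  have h0 : 0 ≤ t.toReal := ENNReal.toReal_nonneg
  have h1 : Real.exp (-t.toReal) * (1 + t.toReal) ≤ 1 := by
    calc Real.exp (-t.toReal) * (1 + t.toReal) ≤ Real.exp (-t.toReal) * Real.exp t.toReal := by
          gcongr
          linarith [Real.add_one_le_exp t.toReal]
      _ = 1 := by rw [← Real.exp_add]; simp
  have h2 : t.toReal ≤ 1 := by nlinarith
  nlinarith

lemma tsum_lt_top_of_tsum_one_sub_expNeg {t : ℕ → ℝ≥0∞} (ht : ∀ n, t n ≠ ∞)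
    (h : ∑' n, (1 - expNeg 1 (t n)) ≠ ∞) : ∑' n, t n < ∞ := by
  have hs := ENNReal.summable_toReal h
  have hev : ∀ᶠ n in atTop, (1 - expNeg 1 (t n)).toReal ≤ 1 / 2 :=
    hs.tendsto_atTop_zero.eventually_le_const (by norm_num)
  have hs' : Summable fun n => (t n).toReal := by
    refine Summable.of_norm_bounded_eventually_nat (hs.mul_left 2) ?_
    filter_upwards [hev] with n hn
    rw [Real.norm_of_nonneg ENNReal.toReal_nonneg]
    exact toReal_le_of_one_sub_expNeg_le (ht n) hn
  have := hs'.tsum_ofReal_ne_top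
  simp_rw [ENNReal.ofReal_toReal (ht _)] at this
  exact lt_top_iff_ne_top.2 this

lemma ne_top_of_expNeg_ne_zero {l : ℝ} {t : ℝ≥0∞} (h : expNeg l t ≠ 0) : t ≠ ∞ := by
  rintro rfl
  exact h (expNeg_top l)

lemma eq_top_of_expNeg_eq_zero {l : ℝ} {t : ℝ≥0∞} (h : expNeg l t = 0) : t = ∞ := by
  by_contra ht
  rw [expNeg_of_ne_top l ht, ENNReal.ofReal_eq_zero] at h
  exact absurd h (not_le.2 (Real.exp_pos _))

/-! ### Passage times of independent walks -/

/-- The time at which the walk started in `n + 1` jumps to `n` for the first time. -/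
def descent {Ω : Type*} (Y : ℕ → Ω → Outcome) (n : ℕ) (ω : Ω) : ℝ≥0∞ :=
  firstJumpTime (Y (n + 1) ω) n

variable {Ω : Type*} [MeasurableSpace Ω] {P : Measure Ω}
  {D : Params} {Y : ℕ → Ω → Outcome}

lemma measurable_descent (hY : ∀ n, IsWalkFrom D P (Y n) n) (n : ℕ) :
    Measurable (descent Y n) :=
  (measurable_firstJumpTime n).comp (hY (n + 1)).measurable

lemma lintegral_expNeg_descent [IsProbabilityMeasure P]
    (hY : ∀ n, IsWalkFrom D P (Y n) n) (l : ℝ) (n : ℕ) :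
    ∫⁻ ω, expNeg l (descent Y n ω) ∂P = D.hitLaplace l n (n + 1) :=
  (hY (n + 1)).lintegral_expNeg l n

/-- The event of implosion in terms of the jump times only, up to a null set. -/
lemma ae_mem_implosionEvent_iff (hY : ∀ n, IsWalkFrom D P (Y n) n) :
    ∀ᵐ ω ∂P, ω ∈ implosionEvent Y ↔ ∑' n, descent Y n ω < ∞ := by
  filter_upwards [ae_all_iff.2 fun n => (hY n).ae_hittingTime] with ω hω
  have : ∀ k, passageTime Y (k + 1) ω = descent Y k ω := fun k => hω (k + 1) k
  simp only [implosionEvent, Set.mem_ofPred_eq, this]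

/-- `θ_1 + ⋯ + θ_N` has the same Laplace transform as the hitting time of `0` from `N`. -/
lemma lintegral_expNeg_sum_descent [IsProbabilityMeasure P]
    (hY : ∀ n, IsWalkFrom D P (Y n) n) (hindep : iIndepFun Y P)
    {l : ℝ} (hl : 0 ≤ l) (N : ℕ) :
    ∫⁻ ω, expNeg l (∑ n ∈ Finset.range N, descent Y n ω) ∂P = D.hitLaplace l 0 N := by
  simp_rw [expNeg_sum]
  have hi : iIndepFun (fun n ω => expNeg l (descent Y n ω)) P :=
    (hindep.precomp (g := fun n : ℕ => n + 1) (add_left_injective 1)).comp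
      (fun n w => expNeg l (firstJumpTime w n))
      (fun n => (measurable_expNeg l).comp (measurable_firstJumpTime n))
  rw [lintegral_prod_eq_prod_lintegral_of_indepFun (Finset.range N)
    (fun n ω => expNeg l (descent Y n ω)) hi
    fun n => (measurable_expNeg l).comp (measurable_descent hY n)]
  simp_rw [lintegral_expNeg_descent hY]
  exact D.prod_hitLaplace hl N

lemma lintegral_expNeg_tsum_descent_le [IsProbabilityMeasure P]
    (hY : ∀ n, IsWalkFrom D P (Y n) n) (hindep : iIndepFun Y P) {l : ℝ} (hl : 0 ≤ l) (N : ℕ) :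
    ∫⁻ ω, expNeg l (∑' n, descent Y n ω) ∂P ≤ D.hitLaplace l 0 N := by
  rw [← lintegral_expNeg_sum_descent hY hindep hl]
  exact lintegral_mono fun ω => expNeg_anti hl (ENNReal.sum_le_tsum _)

/-- If the Laplace transforms of `σ_0` are not bounded away from zero, then `E exp (-ρ_∞) = 0`. -/
lemma measure_implosionEvent_eq_zero [IsProbabilityMeasure P]
    (hY : ∀ n, IsWalkFrom D P (Y n) n) (hindep : iIndepFun Y P)
    (h : ¬ ∃ c, 0 < c ∧ ∀ i, c ≤ D.toZero 1 i) : P (implosionEvent Y) = 0 := by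
  push Not at h
  have h0 : ∫⁻ ω, expNeg 1 (∑' n, descent Y n ω) ∂P = 0 := by
    refine le_antisymm (ENNReal.le_of_forall_pos_le_add fun ε hε _ => ?_) zero_le
    obtain ⟨i, hi⟩ := h ε hε
    refine (lintegral_expNeg_tsum_descent_le hY hindep zero_le_one i).trans ?_
    rw [zero_add, ← D.ofReal_toZero zero_le_one, ← ENNReal.ofReal_coe_nnreal]
    exact ENNReal.ofReal_le_ofReal hi.le
  have hm : Measurable fun ω => expNeg 1 (∑' n, descent Y n ω) :=
    (measurable_expNeg 1).comp (Measurable.tsum fun n => measurable_descent hY n)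
  rw [lintegral_eq_zero_iff hm] at h0
  have : ∀ᵐ ω ∂P, ω ∉ implosionEvent Y := by
    filter_upwards [h0, ae_mem_implosionEvent_iff hY] with ω h1 h2
    rw [h2, eq_top_of_expNeg_eq_zero h1]
    simp
  simpa [ae_iff] using this

lemma ae_descent_ne_top [IsProbabilityMeasure P]
    (hY : ∀ n, IsWalkFrom D P (Y n) n) (hs : D.scaleSeries = ∞) :
    ∀ᵐ ω ∂P, ∀ n, descent Y n ω ≠ ∞ := by
  refine ae_all_iff.2 fun n => ?_
  have h1 : D.hitLaplace 0 n (n + 1) = 1 := by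
    have := D.hitLaplace_mul le_rfl (Nat.le_succ n)
    rw [← D.ofReal_toZero le_rfl, ← D.ofReal_toZero le_rfl, D.toZero_zero_eq_one hs,
      D.toZero_zero_eq_one hs, ENNReal.ofReal_one, mul_one] at this
    exact this.symm
  have hm : Measurable fun ω => expNeg 0 (descent Y n ω) :=
    (measurable_expNeg 0).comp (measurable_descent hY n)
  have hm' : Measurable fun ω => 1 - expNeg 0 (descent Y n ω) := measurable_const.sub hm
  have h2 : ∫⁻ ω, (1 - expNeg 0 (descent Y n ω)) ∂P = 0 := by
    rw [lintegral_sub hm, lintegral_expNeg_descent hY, h1]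
    · simp
    · rw [lintegral_expNeg_descent hY, h1]
      exact ENNReal.one_ne_top
    · exact ae_of_all _ fun ω => expNeg_le_one le_rfl _
  rw [lintegral_eq_zero_iff hm'] at h2
  filter_upwards [h2] with ω hω
  refine ne_top_of_expNeg_ne_zero (l := 0) fun h => ?_
  simp [h] at hω

/-- If the Laplace transforms of `σ_0` are bounded away from zero, then each `θ_n` is finite (the
scale is then infinite), the product
`∏ E exp (-θ_n)` converges to a positive limit, and hence `∑ E (1 - exp (-θ_n))` converges. -/
lemma ae_tsum_descent_lt_top [IsProbabilityMeasure P] (hY : ∀ n, IsWalkFrom D P (Y n) n)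
    (h : ∃ c, 0 < c ∧ ∀ i, c ≤ D.toZero 1 i) : ∀ᵐ ω ∂P, ∑' n, descent Y n ω < ∞ := by
  have hs := (D.exists_le_toZero_iff.1 h).2
  obtain ⟨c, hc, hci⟩ := h
  let u : ℕ → ℝ := fun n => (D.hitLaplace 1 n (n + 1)).toReal
  have hle : ∀ n, D.hitLaplace 1 n (n + 1) ≤ 1 := fun n =>
    D.hitLaplace_le_one zero_le_one (Nat.le_succ n)
  have hu : ∀ n, ENNReal.ofReal (u n) = D.hitLaplace 1 n (n + 1) := fun n =>
    ENNReal.ofReal_toReal ((hle n).trans_lt ENNReal.one_lt_top).ne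
  have hu1 : ∀ n, u n ≤ 1 := fun n => ENNReal.toReal_le_of_le_ofReal
    zero_le_one (by simpa using hle n)
  have hu0 : ∀ n, 0 ≤ u n := fun n => ENNReal.toReal_nonneg
  have hprod : ∀ N, ∏ n ∈ Finset.range N, u n = D.toZero 1 N := by
    intro N
    rw [Params.toZero, ← D.prod_hitLaplace zero_le_one, ENNReal.toReal_prod]
  have hsum : Summable fun n => 1 - u n := by
    refine summable_of_sum_range_le (c := -Real.log c) (fun n => sub_nonneg.2 (hu1 n)) fun N => ?_
    have : c ≤ Real.exp (-∑ n ∈ Finset.range N, (1 - u n)) := by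
      rw [← Finset.sum_neg_distrib, Real.exp_sum]
      refine (hci N).trans ((hprod N).symm.le.trans ?_)
      refine Finset.prod_le_prod (fun n _ => hu0 n) fun n _ => ?_
      linarith [Real.add_one_le_exp (-(1 - u n))]
    have := (Real.log_le_iff_le_exp hc).2 this
    linarith
  have hm : ∀ n, Measurable fun ω => expNeg 1 (descent Y n ω) := fun n =>
    (measurable_expNeg 1).comp (measurable_descent hY n)
  have hm' : ∀ n, Measurable fun ω => 1 - expNeg 1 (descent Y n ω) := fun n =>
    measurable_const.sub (hm n)
  have h1 : ∀ n, ∫⁻ ω, (1 - expNeg 1 (descent Y n ω)) ∂P = ENNReal.ofReal (1 - u n) := by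
    intro n
    rw [lintegral_sub (hm n), lintegral_expNeg_descent hY, ← hu, ENNReal.ofReal_sub _ (hu0 n)]
    · simp
    · rw [lintegral_expNeg_descent hY, ← hu]
      exact ENNReal.ofReal_ne_top
    · exact ae_of_all _ fun ω => expNeg_le_one zero_le_one _
  have h2 : ∫⁻ ω, ∑' n, (1 - expNeg 1 (descent Y n ω)) ∂P ≠ ∞ := by
    rw [lintegral_tsum fun n => (hm' n).aemeasurable]
    simp_rw [h1]
    exact hsum.tsum_ofReal_ne_top
  have h3 := ae_lt_top (Measurable.tsum hm') h2
  filter_upwards [h3, ae_descent_ne_top hY hs] with ω h3 h4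
  exact tsum_lt_top_of_tsum_one_sub_expNeg h4 h3.ne

lemma measure_implosionEvent_eq_one [IsProbabilityMeasure P] (hY : ∀ n, IsWalkFrom D P (Y n) n)
    (h : ∃ c, 0 < c ∧ ∀ i, c ≤ D.toZero 1 i) : P (implosionEvent Y) = 1 := by
  rw [← measure_univ (μ := P)]
  refine measure_congr ?_
  filter_upwards [ae_tsum_descent_lt_top hY h, ae_mem_implosionEvent_iff hY] with ω h1 h2
  exact propext ⟨fun _ => trivial, fun _ => h2.2 h1⟩

/-! ### Implosion in law -/

lemma tendsto_expNeg_inv {t : ℝ≥0∞} (ht : t ≠ ∞) :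
    Tendsto (fun C : ℝ => expNeg C⁻¹ t) atTop (𝓝 1) := by
  simp_rw [expNeg_of_ne_top _ ht]
  rw [← ENNReal.ofReal_one]
  refine ENNReal.tendsto_ofReal ?_
  have : Tendsto (fun C : ℝ => Real.exp (-(C⁻¹ * t.toReal))) atTop
      (𝓝 (Real.exp (-(0 * t.toReal)))) :=
    (Real.continuous_exp.tendsto _).comp (tendsto_inv_atTop_zero.mul_const _).neg
  simpa using this

/-- Markov's inequality for `1 - exp (-σ_0 / C)`. -/
lemma IsWalkFrom.measure_lt_hittingTime_le [IsProbabilityMeasure P] {W : Ω → Outcome} {i : ℕ}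
    (h : IsWalkFrom D P W i) {C : ℝ} (hC : 0 < C) :
    ENNReal.ofReal (1 - Real.exp (-1)) * P {ω | ENNReal.ofReal C < (W ω).hittingTime 0} ≤
      1 - D.hitLaplace C⁻¹ 0 i := by
  have hl : 0 ≤ C⁻¹ := (inv_pos.2 hC).le
  have hm : Measurable fun ω => expNeg C⁻¹ (firstJumpTime (W ω) 0) :=
    (measurable_expNeg _).comp ((measurable_firstJumpTime 0).comp h.measurable)
  have hm' : Measurable fun ω => 1 - expNeg C⁻¹ (firstJumpTime (W ω) 0) := measurable_const.sub hm
  have e : ∫⁻ ω, (1 - expNeg C⁻¹ (firstJumpTime (W ω) 0)) ∂P = 1 - D.hitLaplace C⁻¹ 0 i := by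
    rw [lintegral_sub hm, h.lintegral_expNeg]
    · simp [Params.hitLaplace]
    · rw [h.lintegral_expNeg]
      exact ((D.hitLaplace_le_one hl (Nat.zero_le i)).trans_lt ENNReal.one_lt_top).ne
    · exact ae_of_all _ fun ω => expNeg_le_one hl _
  rw [← e]
  refine le_trans ?_ (mul_meas_ge_le_lintegral hm' (ENNReal.ofReal (1 - Real.exp (-1))))
  refine mul_le_mul_right (measure_mono_ae ?_) _
  filter_upwards [h.ae_hittingTime] with ω hω hlt
  change ENNReal.ofReal C < (W ω).hittingTime 0 at hlt
  change ENNReal.ofReal (1 - Real.exp (-1)) ≤ 1 - expNeg C⁻¹ (firstJumpTime (W ω) 0)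
  rw [hω] at hlt
  have h1 := expNeg_anti hl hlt.le
  rw [expNeg_of_ne_top _ ENNReal.ofReal_ne_top, ENNReal.toReal_ofReal hC.le,
    inv_mul_cancel₀ hC.ne'] at h1
  rw [ENNReal.ofReal_sub _ (Real.exp_pos _).le, ENNReal.ofReal_one]
  exact tsub_le_tsub_left h1 _

/-- The Laplace transforms at `1 / C` of all the `σ_0` are at least that of `ρ_∞`, which tends to
`1` as `C → ∞`; so Markov's inequality is uniform in the initial state. -/
lemma implodesInLaw_of_ae_tsum_descent_lt_top [IsProbabilityMeasure P]
    (hY : ∀ n, IsWalkFrom D P (Y n) n) (hindep : iIndepFun Y P)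
    (h : ∀ᵐ ω ∂P, ∑' n, descent Y n ω < ∞) : ImplodesInLaw P Y := by
  let ε := ENNReal.ofReal (1 - Real.exp (-1))
  have hε : ε ≠ 0 := by
    simp [ε]
  have hm : Measurable fun ω => ∑' n, descent Y n ω :=
    Measurable.tsum fun n => measurable_descent hY n
  have hlim : Tendsto (fun C : ℝ => ∫⁻ ω, expNeg C⁻¹ (∑' n, descent Y n ω) ∂P) atTop (𝓝 1) := by
    have := tendsto_lintegral_filter_of_dominated_convergence (μ := P) (l := (atTop : Filter ℝ))
      (F := fun C ω => expNeg C⁻¹ (∑' n, descent Y n ω)) (f := fun _ => 1) (fun _ => 1)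
      (Eventually.of_forall fun C => (measurable_expNeg _).comp hm)
      (by
        filter_upwards [eventually_gt_atTop 0] with C hC
        exact ae_of_all _ fun ω => expNeg_le_one (inv_pos.2 hC).le _)
      (by simp)
      (by
        filter_upwards [h] with ω hω
        exact tendsto_expNeg_inv hω.ne)
    simpa using this
  have hlim' : Tendsto (fun C : ℝ => (1 - ∫⁻ ω, expNeg C⁻¹ (∑' n, descent Y n ω) ∂P) / ε)
      atTop (𝓝 0) := by
    have h1 := ENNReal.Tendsto.div_const
      (ENNReal.Tendsto.sub tendsto_const_nhds hlim (Or.inl ENNReal.one_ne_top)) (b := ε) (Or.inr hε)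
    simpa using h1
  refine tendsto_of_tendsto_of_tendsto_of_le_of_le' tendsto_const_nhds hlim'
    (Eventually.of_forall fun _ => zero_le) ?_
  filter_upwards [eventually_gt_atTop 0] with C hC
  refine iSup_le fun i => ?_
  rw [ENNReal.le_div_iff_mul_le (Or.inl hε) (Or.inl ENNReal.ofReal_ne_top), mul_comm]
  refine ((hY i).measure_lt_hittingTime_le hC).trans (tsub_le_tsub_left ?_ _)
  exact lintegral_expNeg_tsum_descent_le hY hindep (inv_pos.2 hC).le i

/-- If `P_i (σ_0 ≤ C) ≥ 1 / 2` for all `i`, then `E_i exp (-σ_0) ≥ exp (-C) / 2`. -/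
lemma exists_le_toZero_of_implodesInLaw [IsProbabilityMeasure P]
    (hY : ∀ n, IsWalkFrom D P (Y n) n) (h : ImplodesInLaw P Y) :
    ∃ c, 0 < c ∧ ∀ i, c ≤ D.toZero 1 i := by
  obtain ⟨C, hC, hC0⟩ := ((h.eventually_le_const (u := 2⁻¹) (by simp)).and
    (eventually_ge_atTop 0)).exists
  refine ⟨Real.exp (-C) * 2⁻¹, by positivity, fun i => ?_⟩
  have hi := (le_iSup (fun i => P {ω | ENNReal.ofReal C < (Y i ω).hittingTime 0}) i).trans hC
  have hm : Measurable fun ω => expNeg 1 (firstJumpTime (Y i ω) 0) :=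
    (measurable_expNeg _).comp ((measurable_firstJumpTime 0).comp (hY i).measurable)
  have h1 : 2⁻¹ ≤ P {ω | ENNReal.ofReal (Real.exp (-C)) ≤ expNeg 1 (firstJumpTime (Y i ω) 0)} := by
    have hu : (1 : ℝ≥0∞) ≤ P {ω | ENNReal.ofReal C < (Y i ω).hittingTime 0} +
        P {ω | ENNReal.ofReal (Real.exp (-C)) ≤ expNeg 1 (firstJumpTime (Y i ω) 0)} := by
      rw [← measure_univ (μ := P)]
      refine le_trans (measure_mono_ae ?_) (measure_union_le _ _)
      filter_upwards [(hY i).ae_hittingTime] with ω hω _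
      rcases lt_or_ge (ENNReal.ofReal C) ((Y i ω).hittingTime 0) with hlt | hge
      · exact Or.inl hlt
      · right
        rw [hω] at hge
        have := expNeg_anti zero_le_one hge
        rwa [expNeg_of_ne_top _ ENNReal.ofReal_ne_top, ENNReal.toReal_ofReal hC0, one_mul] at this
    have h2 := hu.trans (add_le_add_left hi _)
    rw [← ENNReal.inv_two_add_inv_two] at h2
    exact (ENNReal.add_le_add_iff_left (by simp)).1 h2
  have h3 : ENNReal.ofReal (Real.exp (-C)) * 2⁻¹ ≤ D.hitLaplace 1 0 i := by
    have h4 := mul_meas_ge_le_lintegral hm (ENNReal.ofReal (Real.exp (-C))) (μ := P)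
    rw [(hY i).lintegral_expNeg] at h4
    exact (mul_le_mul_right h1 _).trans h4
  rw [← D.ofReal_toZero zero_le_one] at h3
  have h5 : ENNReal.ofReal (Real.exp (-C) * 2⁻¹) ≤ ENNReal.ofReal (D.toZero 1 i) := by
    rwa [ENNReal.ofReal_mul (Real.exp_pos _).le, ENNReal.ofReal_inv_of_pos two_pos,
      ENNReal.ofReal_ofNat]
  exact (ENNReal.ofReal_le_ofReal_iff (D.toZero_nonneg i)).1 h5

end CTRW

end

theorem theorem2 {Ω : Type*} [MeasurableSpace Ω] (P : Measure Ω) [IsProbabilityMeasure P]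
    (D : CTRW.Params) (Y : ℕ → Ω → CTRW.Outcome)
    (hY : ∀ n, CTRW.IsWalkFrom D P (Y n) n) (hindep : iIndepFun Y P) :
    (P (CTRW.implosionEvent Y) = 0 ∨ P (CTRW.implosionEvent Y) = 1) ∧
    (P (CTRW.implosionEvent Y) = 1 ↔ D.implosionSeries < ∞ ∧ D.scaleSeries = ∞) ∧
    (P (CTRW.implosionEvent Y) = 0 ↔ D.implosionSeries = ∞ ∨ D.scaleSeries < ∞) ∧
    (CTRW.ImplodesInLaw P Y ↔ D.implosionSeries < ∞ ∧ D.scaleSeries = ∞) := by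
  have hneg : D.implosionSeries = ∞ ∨ D.scaleSeries < ∞ ↔
      ¬ (D.implosionSeries < ∞ ∧ D.scaleSeries = ∞) := by
    rw [not_and_or, not_lt_top_iff, ← ne_eq, ← lt_top_iff_ne_top]
  rw [hneg, ← D.exists_le_toZero_iff]
  by_cases h : ∃ c, 0 < c ∧ ∀ i, c ≤ D.toZero 1 i
  · have h1 := CTRW.measure_implosionEvent_eq_one hY h
    have h2 := CTRW.implodesInLaw_of_ae_tsum_descent_lt_top hY hindep
      (CTRW.ae_tsum_descent_lt_top hY h)
    simp [h1, h, h2]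
  · have h0 := CTRW.measure_implosionEvent_eq_zero hY hindep h
    have h2 : ¬ CTRW.ImplodesInLaw P Y := fun H =>
      h (CTRW.exists_le_toZero_of_implodesInLaw hY H)
    simp [h0, h, h2]
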